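/- Let $M$ be a connected smooth manifold of dimension $2n+1$ with a smooth almost contact metric structure $(\varphi,\xi,\eta,g)$: $g$ is a Riemannian metric, $\varphi$ a $(1,1)$-tensor field, $\xi$ a vector field and $\eta$ a 1-form such that, for all vector fields $X,Y$, $$\varphi^2=-I+\eta\otimes\xi,\quad \eta(\xi)=1,\quad \eta\circ\varphi=0,\quad \varphi(\xi)=0,\quad \eta(X)=g(X,\xi),\quad g(\varphi X,\varphi Y)=g(X,Y)-\eta(X)\eta(Y).$$ Let $\nabla$ be the Levi-Civita connection of $g$, $R(X,Y)Z=\nabla_X\nabla_YZ-\nabla_Y\nabla_XZ-\nabla_{[X,Y]}Z$ its curvature tensor, $S(Y,Z)=\operatorname{tr}(X\mapsto R(X,Y)Z)$ its Ricci tensor, and $\mathcal L_Vg$ the Lie derivative of $g$ along a vector field $V$. Suppose that $M$ is a regular $f$-Kenmotsu manifold, that is, $f\in C^\infty(M)$ is strictly positive, $df\wedge\eta=0$, $$(\nabla_X\varphi)(Y)=f\,\bigl(g(\varphi X,Y)\,\xi-\eta(Y)\,\varphi X\bigr)\quad\text{for all } X,Y,$$ and the function $f^2+\xi(f)$ vanishes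 nowhere. Let $V$ be a smooth vector field on $M$. (1) If the $(0,2)$-tensor field $\mathcal L_Vg+2S$ is parallel, i.e. $\nabla(\mathcal L_Vg+2S)=0$, then there is a real constant $\lambda$ such that $\mathcal L_Vg+2S+2\lambda g=0$, i.e. $(g,V,\lambda)$ is a Ricci soliton. (2) If $M$ is Ricci-semisymmetric ($R\cdot S=0$, i.e. $S(R(X,Y)X_1,X_2)+S(X_1,R(X,Y)X_2)=0$ for all $X,Y,X_1,X_2$) or semisymmetric ($R\cdot R=0$, where $R(X,Y)$ acts as a derivation on the tensor field $R$), and $\mathcal L_Vg$ is parallel, then again there is a real constant $\lambda$ such that $\mathcal L_Vg+2S+2\lambda g=0$. -/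

import Mathlib

open Bundle VectorField
open scoped Manifold ContDiff Topology

namespace FKenmotsu

section LeviCivita

variable {E : Type*} [NormedAddCommGroup E] [NormedSpace ℝ E]
  {H : Type*} [TopologicalSpace H] {I : ModelWithCorners ℝ E H}
  {M : Type*} [TopologicalSpace M] [ChartedSpace H M]

theorem finiteDimensional_tangentSpace [FiniteDimensional ℝ E] [IsManifold I ∞ M] (x : M) :
    FiniteDimensional ℝ (TangentSpace I x) :=
  VectorBundle.finiteDimensional ℝ E (fun x : M ↦ TangentSpace I x) x

variable [RiemannianBundle (fun x : M ↦ TangentSpace I x)]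

/-- The right-hand side of the Koszul formula for `2 g(∇_X Y, Z)`. -/
noncomputable def koszul (Y X Z : Π x : M, TangentSpace I x) (x : M) : ℝ :=
  mvfderiv I (fun y ↦ inner ℝ (Y y) (Z y)) x (X x)
    + mvfderiv I (fun y ↦ inner ℝ (X y) (Z y)) x (Y x)
    - mvfderiv I (fun y ↦ inner ℝ (X y) (Y y)) x (Z x)
    + inner ℝ (mlieBracket I X Y x) (Z x)
    - inner ℝ (mlieBracket I X Z x) (Y x)
    - inner ℝ (mlieBracket I Y Z x) (X x)

section Koszul

variable [IsManifold I ∞ M] [IsContMDiffRiemannianBundle I ∞ E (fun x : M ↦ TangentSpace I x)]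
  {X X' Y Y' Z Z' : Π x : M, TangentSpace I x} {f : M → ℝ} {x : M}

theorem mdiff_inner (hX : MDiffAt (T% X) x) (hY : MDiffAt (T% Y) x) :
    MDiffAt (fun y ↦ inner ℝ (X y) (Y y)) x :=
  MDifferentiableAt.inner_bundle (F := E) (E := fun x : M ↦ TangentSpace I x) (b := fun y ↦ y)
    (IB := I) hX hY

theorem deriv_inner_smul (hf : MDiffAt f x) (hX : MDiffAt (T% X) x) (hZ : MDiffAt (T% Z) x)
    (v : TangentSpace I x) :
    mvfderiv I (fun y ↦ inner ℝ ((f • X) y) (Z y)) x v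
      = f x * mvfderiv I (fun y ↦ inner ℝ (X y) (Z y)) x v
        + mvfderiv I f x v * inner ℝ (X x) (Z x) := by
  have h : (fun y ↦ inner ℝ ((f • X) y) (Z y)) = fun y ↦ f y * inner ℝ (X y) (Z y) := by
    ext y; simp [inner_smul_left]
  rw [h, mvfderiv_fun_mul hf (mdiff_inner hX hZ)]
  simp
  ring

theorem deriv_inner_smul' (hf : MDiffAt f x) (hX : MDiffAt (T% X) x) (hZ : MDiffAt (T% Z) x)
    (v : TangentSpace I x) :
    mvfderiv I (fun y ↦ inner ℝ (Z y) ((f • X) y)) x v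
      = f x * mvfderiv I (fun y ↦ inner ℝ (Z y) (X y)) x v
        + mvfderiv I f x v * inner ℝ (Z x) (X x) := by
  simp only [fun y ↦ real_inner_comm (X y) (Z y), fun y ↦ real_inner_comm ((f • X) y) (Z y)]
  exact deriv_inner_smul hf hX hZ v

theorem deriv_inner_add (hX : MDiffAt (T% X) x) (hX' : MDiffAt (T% X') x)
    (hZ : MDiffAt (T% Z) x) (v : TangentSpace I x) :
    mvfderiv I (fun y ↦ inner ℝ ((X + X') y) (Z y)) x v
      = mvfderiv I (fun y ↦ inner ℝ (X y) (Z y)) x v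
        + mvfderiv I (fun y ↦ inner ℝ (X' y) (Z y)) x v := by
  have h : (fun y ↦ inner ℝ ((X + X') y) (Z y))
      = fun y ↦ inner ℝ (X y) (Z y) + inner ℝ (X' y) (Z y) := by
    ext y; simp [inner_add_left]
  rw [h, mvfderiv_fun_add (mdiff_inner hX hZ) (mdiff_inner hX' hZ)]
  simp

theorem deriv_inner_add' (hX : MDiffAt (T% X) x) (hX' : MDiffAt (T% X') x)
    (hZ : MDiffAt (T% Z) x) (v : TangentSpace I x) :
    mvfderiv I (fun y ↦ inner ℝ (Z y) ((X + X') y)) x v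
      = mvfderiv I (fun y ↦ inner ℝ (Z y) (X y)) x v
        + mvfderiv I (fun y ↦ inner ℝ (Z y) (X' y)) x v := by
  simp only [fun y ↦ real_inner_comm (X y) (Z y), fun y ↦ real_inner_comm (X' y) (Z y),
    fun y ↦ real_inner_comm ((X + X') y) (Z y)]
  exact deriv_inner_add hX hX' hZ v

variable [CompleteSpace E]

theorem koszul_tensorial_left (hY : MDiffAt (T% Y) x) (hZ : MDiffAt (T% Z) x) :
    TensorialAt I E (fun X : Π x : M, TangentSpace I x ↦ koszul Y X Z x) x where
  smul {f X} hf hX := by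
    simp only [koszul]
    rw [deriv_inner_smul hf hX hZ, deriv_inner_smul hf hX hY]
    simp only [mlieBracket_smul_left hf hX, Pi.smul_apply', inner_add_left, inner_smul_left,
      inner_smul_right, map_smul, smul_eq_mul, conj_trivial]
    ring
  add {X X'} hX hX' := by
    simp only [koszul]
    rw [deriv_inner_add hX hX' hZ, deriv_inner_add hX hX' hY]
    simp only [mlieBracket_add_left hX hX', Pi.add_apply, inner_add_left, inner_add_right, map_add]
    ring

theorem koszul_tensorial_right (hY : MDiffAt (T% Y) x) (hX : MDiffAt (T% X) x) :
    TensorialAt I E (fun Z : Π x : M, TangentSpace I x ↦ koszul Y X Z x) x where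
  smul {f Z} hf hZ := by
    simp only [koszul]
    rw [deriv_inner_smul' hf hZ hX, deriv_inner_smul' hf hZ hY]
    simp only [mlieBracket_smul_right hf hZ, Pi.smul_apply', inner_add_left, inner_smul_left,
      inner_smul_right, map_smul, smul_eq_mul, conj_trivial]
    rw [real_inner_comm (Z x) (X x), real_inner_comm (Z x) (Y x)]
    ring
  add {Z Z'} hZ hZ' := by
    simp only [koszul]
    rw [deriv_inner_add' hZ hZ' hX, deriv_inner_add' hZ hZ' hY]
    simp only [mlieBracket_add_right hZ hZ', Pi.add_apply, inner_add_left, inner_add_right, map_add]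
    ring

theorem koszul_add (hY : MDiffAt (T% Y) x) (hY' : MDiffAt (T% Y') x) (hX : MDiffAt (T% X) x)
    (hZ : MDiffAt (T% Z) x) :
    koszul (Y + Y') X Z x = koszul Y X Z x + koszul Y' X Z x := by
  simp only [koszul]
  rw [deriv_inner_add hY hY' hZ, deriv_inner_add' hY hY' hX]
  simp only [mlieBracket_add_left hY hY', mlieBracket_add_right hY hY', Pi.add_apply,
    inner_add_left, inner_add_right, map_add]
  ring

theorem koszul_smul (hf : MDiffAt f x) (hY : MDiffAt (T% Y) x) (hX : MDiffAt (T% X) x)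
    (hZ : MDiffAt (T% Z) x) :
    koszul (f • Y) X Z x
      = f x * koszul Y X Z x + 2 * (mvfderiv I f x (X x) * inner ℝ (Y x) (Z x)) := by
  simp only [koszul]
  rw [deriv_inner_smul hf hY hZ, deriv_inner_smul' hf hY hX]
  simp only [mlieBracket_smul_left hf hY, mlieBracket_smul_right hf hY, Pi.smul_apply',
    inner_add_left, inner_smul_left, inner_smul_right, map_smul, smul_eq_mul, conj_trivial]
  rw [real_inner_comm (Y x) (X x)]
  ring

end Koszul

variable [FiniteDimensional ℝ E] [IsManifold I ∞ M]
  [IsContMDiffRiemannianBundle I ∞ E (fun x : M ↦ TangentSpace I x)]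

open scoped Classical in
/-- The bilinear form `(X, Z) ↦ 2 g(∇_X Y, Z)` on the tangent space at `x`, for a vector field `Y`
that is differentiable at `x` (and `0` otherwise). -/
noncomputable def koszulForm (Y : Π x : M, TangentSpace I x) (x : M) :
    TangentSpace I x →L[ℝ] TangentSpace I x →L[ℝ] ℝ :=
  haveI : CompleteSpace E := FiniteDimensional.complete ℝ E
  if hY : MDiffAt (T% Y) x then
    TensorialAt.mkHom₂ (fun X Z : Π x : M, TangentSpace I x ↦ koszul Y X Z x) x
      (fun _ hZ ↦ koszul_tensorial_left hY hZ) (fun _ hX ↦ koszul_tensorial_right hY hX)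
  else 0

theorem koszulForm_apply {X Y Z : Π x : M, TangentSpace I x} {x : M} (hY : MDiffAt (T% Y) x)
    (hX : MDiffAt (T% X) x) (hZ : MDiffAt (T% Z) x) :
    koszulForm Y x (X x) (Z x) = koszul Y X Z x := by
  have : CompleteSpace E := FiniteDimensional.complete ℝ E
  rw [koszulForm, dif_pos hY]
  exact TensorialAt.mkHom₂_apply _ _ hX hZ

theorem koszulForm_apply_extend {Y : Π x : M, TangentSpace I x} {x : M} (hY : MDiffAt (T% Y) x)
    (u w : TangentSpace I x) :
    koszulForm Y x u w
      = koszul Y (FiberBundle.extend E u) (FiberBundle.extend E w) x := by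
  rw [← koszulForm_apply hY (FiberBundle.mdifferentiableAt_extend ..) (FiberBundle.mdifferentiableAt_extend ..)]
  simp

/-- `∇Y` at `x`, as a linear endomorphism `u ↦ ∇_u Y` of the tangent space at `x`: the vector
`∇_u Y` is the one with `2 g(∇_u Y, w)` given by the Koszul formula, for all `w`. -/
noncomputable def leviCivitaFun (Y : Π x : M, TangentSpace I x) (x : M) :
    TangentSpace I x →L[ℝ] TangentSpace I x :=
  haveI := finiteDimensional_tangentSpace (I := I) x
  haveI : CompleteSpace (TangentSpace I x) := FiniteDimensional.complete ℝ _
  InnerProductSpace.continuousLinearMapOfBilin (𝕜 := ℝ) ((1 / 2 : ℝ) • koszulForm Y x)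

theorem inner_leviCivitaFun (Y : Π x : M, TangentSpace I x) (x : M) (u w : TangentSpace I x) :
    inner ℝ (leviCivitaFun Y x u) w = 1 / 2 * koszulForm Y x u w := by
  have := finiteDimensional_tangentSpace (I := I) x
  have : CompleteSpace (TangentSpace I x) := FiniteDimensional.complete ℝ _
  exact InnerProductSpace.continuousLinearMapOfBilin_apply (𝕜 := ℝ) _ _ _

variable (I M) in
/-- The Levi-Civita connection of the metric; `leviCivita I M Y x u` is `∇_u Y`. -/
noncomputable def leviCivita : CovariantDerivative I E (fun x : M ↦ TangentSpace I x) where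
  toFun Y x := leviCivitaFun Y x
  isCovariantDerivativeOnUniv :=
    { add := by
        intro Y Y' x hY hY' _
        have : CompleteSpace E := FiniteDimensional.complete ℝ E
        ext1 u
        refine ext_inner_right ℝ fun w ↦ ?_
        rw [add_apply, inner_add_left, inner_leviCivitaFun,
          inner_leviCivitaFun, inner_leviCivitaFun, koszulForm_apply_extend hY,
          koszulForm_apply_extend hY', koszulForm_apply_extend (mdifferentiableAt_add_section hY hY'),
          koszul_add hY hY' (FiberBundle.mdifferentiableAt_extend ..) (FiberBundle.mdifferentiableAt_extend ..)]
        ring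
      leibniz := by
        intro Y f x hY hf _
        have : CompleteSpace E := FiniteDimensional.complete ℝ E
        ext1 u
        refine ext_inner_right ℝ fun w ↦ ?_
        rw [add_apply, inner_add_left, smul_apply,
          inner_smul_left, ContinuousLinearMap.smulRight_apply, inner_smul_left,
          inner_leviCivitaFun, inner_leviCivitaFun, koszulForm_apply_extend hY,
          koszulForm_apply_extend (hf.smul_section hY),
          koszul_smul hf hY (FiberBundle.mdifferentiableAt_extend ..) (FiberBundle.mdifferentiableAt_extend ..)]
        simp
        ring }

theorem two_mul_inner_leviCivita {X Y Z : Π x : M, TangentSpace I x} {x : M}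
    (hY : MDiffAt (T% Y) x) (hX : MDiffAt (T% X) x) (hZ : MDiffAt (T% Z) x) :
    2 * inner ℝ (leviCivita I M Y x (X x)) (Z x) = koszul Y X Z x := by
  rw [← koszulForm_apply hY hX hZ]
  change 2 * inner ℝ (leviCivitaFun Y x (X x)) (Z x) = _
  rw [inner_leviCivitaFun]
  ring

/-- The connection defined above is torsion-free. -/
theorem leviCivita_torsion {X Y : Π x : M, TangentSpace I x} {x : M}
    (hX : MDiffAt (T% X) x) (hY : MDiffAt (T% Y) x) :
    leviCivita I M Y x (X x) - leviCivita I M X x (Y x) = mlieBracket I X Y x := by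
  refine ext_inner_right ℝ fun w ↦ ?_
  obtain ⟨Z, hZ, rfl⟩ : ∃ Z : Π x : M, TangentSpace I x, MDiffAt (T% Z) x ∧ Z x = w :=
    ⟨FiberBundle.extend E w, FiberBundle.mdifferentiableAt_extend .., by simp⟩
  have h₁ := two_mul_inner_leviCivita hY hX hZ
  have h₂ := two_mul_inner_leviCivita hX hY hZ
  rw [koszul] at h₁ h₂
  simp only [fun y ↦ real_inner_comm (X y) (Y y)] at h₁ h₂
  rw [mlieBracket_swap_apply (V := Y) (W := X), inner_neg_left] at h₂
  rw [inner_sub_left]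
  linarith

/-- The connection defined above is compatible with the metric. -/
theorem leviCivita_metric {X Y Z : Π x : M, TangentSpace I x} {x : M}
    (hX : MDiffAt (T% X) x) (hY : MDiffAt (T% Y) x) (hZ : MDiffAt (T% Z) x) :
    mvfderiv I (fun y ↦ inner ℝ (Y y) (Z y)) x (X x)
      = inner ℝ (leviCivita I M Y x (X x)) (Z x) + inner ℝ (Y x) (leviCivita I M Z x (X x)) := by
  have h₁ := two_mul_inner_leviCivita hY hX hZ
  have h₂ := two_mul_inner_leviCivita hZ hX hY
  rw [koszul] at h₁ h₂
  simp only [fun y ↦ real_inner_comm (Y y) (Z y)] at h₁ h₂ ⊢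
  rw [mlieBracket_swap_apply (V := Z) (W := Y), inner_neg_left] at h₂
  rw [real_inner_comm _ (Y x)]
  linarith

end LeviCivita

/-! Below, tensors at a point `x` are evaluated on tangent vectors at `x` by extending these to
vector fields that are smooth near `x` (`FiberBundle.extend`); the values do not depend on the
extensions. -/

section Tensors

variable {E : Type*} [NormedAddCommGroup E] [NormedSpace ℝ E] [FiniteDimensional ℝ E]
  {H : Type*} [TopologicalSpace H] {I : ModelWithCorners ℝ E H}
  {M : Type*} [TopologicalSpace M] [ChartedSpace H M] [IsManifold I ∞ M]
  [RiemannianBundle (fun x : M ↦ TangentSpace I x)]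
  [IsContMDiffRiemannianBundle I ∞ E (fun x : M ↦ TangentSpace I x)]

/-- The curvature tensor `R(X, Y)Z = ∇_X ∇_Y Z - ∇_Y ∇_X Z - ∇_[X, Y] Z`, evaluated on tangent
vectors. -/
noncomputable def curvature {x : M} (u v w : TangentSpace I x) : TangentSpace I x :=
  let X : Π y : M, TangentSpace I y := FiberBundle.extend E u
  let Y : Π y : M, TangentSpace I y := FiberBundle.extend E v
  let Z : Π y : M, TangentSpace I y := FiberBundle.extend E w
  leviCivita I M (fun y ↦ leviCivita I M Z y (Y y)) x (X x)
    - leviCivita I M (fun y ↦ leviCivita I M Z y (X y)) x (Y x)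
    - leviCivita I M Z x (mlieBracket I X Y x)

variable (I M) in
/-- The Ricci tensor: `S(v, w)` is the trace of `u ↦ R(u, v)w`. -/
noncomputable def ricci (x : M) (v w : TangentSpace I x) : ℝ :=
  haveI := finiteDimensional_tangentSpace (I := I) x
  ∑ i, inner ℝ (curvature (stdOrthonormalBasis ℝ (TangentSpace I x) i) v w)
    (stdOrthonormalBasis ℝ (TangentSpace I x) i)

/-- The Lie derivative of the metric,
`(L_V g)(X, Y) = V(g(X, Y)) - g([V, X], Y) - g(X, [V, Y])`. -/
noncomputable def lieDerivMetric (V : Π x : M, TangentSpace I x) (x : M)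
    (u v : TangentSpace I x) : ℝ :=
  let X : Π y : M, TangentSpace I y := FiberBundle.extend E u
  let Y : Π y : M, TangentSpace I y := FiberBundle.extend E v
  mvfderiv I (fun y ↦ inner ℝ (X y) (Y y)) x (V x)
    - inner ℝ (mlieBracket I V X x) (Y x) - inner ℝ (X x) (mlieBracket I V Y x)

/-- The covariant derivative of a `(0,2)`-tensor field `α`,
`(∇_X α)(Y, Z) = X(α(Y, Z)) - α(∇_X Y, Z) - α(Y, ∇_X Z)`. -/
noncomputable def covDerivTwoTensor (α : Π x : M, TangentSpace I x → TangentSpace I x → ℝ) (x : M)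
    (u v w : TangentSpace I x) : ℝ :=
  let Y : Π y : M, TangentSpace I y := FiberBundle.extend E v
  let Z : Π y : M, TangentSpace I y := FiberBundle.extend E w
  mvfderiv I (fun y ↦ α y (Y y) (Z y)) x u
    - α x (leviCivita I M Y x u) (Z x) - α x (Y x) (leviCivita I M Z x u)

/-- A `(0,2)`-tensor field `α` is parallel if `∇α = 0`. -/
def IsParallel (α : Π x : M, TangentSpace I x → TangentSpace I x → ℝ) : Prop :=
  ∀ (x : M) (u v w : TangentSpace I x), covDerivTwoTensor α x u v w = 0

/-- The covariant derivative of a `(1,1)`-tensor field, `(∇_X φ)Y = ∇_X(φY) - φ(∇_X Y)`. -/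
noncomputable def covDerivEndo (φ : Π x : M, TangentSpace I x →L[ℝ] TangentSpace I x) (x : M)
    (u v : TangentSpace I x) : TangentSpace I x :=
  let Y : Π y : M, TangentSpace I y := FiberBundle.extend E v
  leviCivita I M (fun y ↦ φ y (Y y)) x u - φ x (leviCivita I M Y x u)

variable (I M) in
/-- Ricci-semisymmetry, `R · S = 0`. -/
def IsRicciSemisymmetric : Prop :=
  ∀ (x : M) (X Y X₁ X₂ : TangentSpace I x),
    -ricci I M x (curvature X Y X₁) X₂ - ricci I M x X₁ (curvature X Y X₂) = 0

variable (I M) in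
/-- Semisymmetry, `R · R = 0`. -/
def IsSemisymmetric : Prop :=
  ∀ (x : M) (X Y X₁ X₂ X₃ : TangentSpace I x),
    curvature X Y (curvature X₁ X₂ X₃) - curvature (curvature X Y X₁) X₂ X₃
      - curvature X₁ (curvature X Y X₂) X₃ - curvature X₁ X₂ (curvature X Y X₃) = 0

/-- `(g, V, lam)` is a Ricci soliton: `L_V g + 2 S + 2 lam g = 0`. -/
def IsRicciSoliton (V : Π x : M, TangentSpace I x) (lam : ℝ) : Prop :=
  ∀ (x : M) (u v : TangentSpace I x),
    lieDerivMetric V x u v + 2 * ricci I M x u v + 2 * lam * inner ℝ u v = 0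

variable (I M) in
/-- A smooth almost contact metric structure `(φ, ξ, η, g)`, where `g` is the given metric. -/
structure AlmostContactMetricStructure where
  φ : Π x : M, TangentSpace I x →L[ℝ] TangentSpace I x
  ξ : Π x : M, TangentSpace I x
  η : Π x : M, TangentSpace I x →L[ℝ] ℝ
  smooth_φ : ContMDiff I (I.prod 𝓘(ℝ, E →L[ℝ] E)) ∞ fun x ↦
    (TotalSpace.mk' (E →L[ℝ] E) x (φ x) :
      TotalSpace (E →L[ℝ] E) fun x : M ↦ TangentSpace I x →L[ℝ] TangentSpace I x)
  smooth_ξ : ContMDiff I (I.prod 𝓘(ℝ, E)) ∞ fun x ↦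
    (TotalSpace.mk' E x (ξ x) : TotalSpace E fun x : M ↦ TangentSpace I x)
  smooth_η : ContMDiff I (I.prod 𝓘(ℝ, E →L[ℝ] ℝ)) ∞ fun x ↦
    (TotalSpace.mk' (E →L[ℝ] ℝ) x (η x) :
      TotalSpace (E →L[ℝ] ℝ) fun x : M ↦ TangentSpace I x →L[ℝ] Bundle.Trivial M ℝ x)
  φ_sq : ∀ (x : M) (u : TangentSpace I x), φ x (φ x u) = -u + η x u • ξ x
  η_ξ : ∀ x : M, η x (ξ x) = 1
  η_φ : ∀ (x : M) (u : TangentSpace I x), η x (φ x u) = 0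
  φ_ξ : ∀ x : M, φ x (ξ x) = 0
  η_eq : ∀ (x : M) (u : TangentSpace I x), η x u = inner ℝ u (ξ x)
  inner_φ : ∀ (x : M) (u v : TangentSpace I x),
    inner ℝ (φ x u) (φ x v) = inner ℝ u v - η x u * η x v

/-- The structure is `f`-Kenmotsu: `f` is smooth and positive, `df ∧ η = 0`, and
`(∇_X φ)Y = f (g(φX, Y)ξ - η(Y)φX)`. -/
structure IsFKenmotsu (C : AlmostContactMetricStructure I M) (f : M → ℝ) : Prop where
  smooth : ContMDiff I 𝓘(ℝ) ∞ f
  pos : ∀ x : M, 0 < f x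
  wedge : ∀ (x : M) (u v : TangentSpace I x),
    mvfderiv I f x u * C.η x v - mvfderiv I f x v * C.η x u = 0
  covDeriv_φ : ∀ (x : M) (u v : TangentSpace I x),
    covDerivEndo C.φ x u v = f x • (inner ℝ (C.φ x u) v • C.ξ x - C.η x v • C.φ x u)

/-- Regularity: `f² + ξ(f)` vanishes nowhere. -/
def IsRegular (C : AlmostContactMetricStructure I M) (f : M → ℝ) : Prop :=
  ∀ x : M, f x ^ 2 + mvfderiv I f x (C.ξ x) ≠ 0

end Tensors

end FKenmotsu

/-! Write F = f² + ξ(f). Evaluating the formula for ∇φ on ξ gives ∇_X ξ = f (X - η(X)ξ). Since df is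
a multiple of η, differentiating once more gives R(X,Y)ξ = F (η(X)Y - η(Y)X), which is `curv_reeb`.

Let A be a symmetric (0,2)-tensor with A(R(X,Y)Z,W) + A(Z,R(X,Y)W) = 0. Taking X = Z = W = ξ and
cancelling the nowhere vanishing F yields A(Y,ξ) = η(Y) A(ξ,ξ). Taking only X = W = ξ then yields A
= A(ξ,ξ) g (`form_eq_mul_metric`). A parallel A satisfies the condition by the Ricci identity
(`curv_form_eq_zero`), and in that case the factor A(ξ,ξ) is constant because g is parallel too.

Part (1) is the case A = L_V g + 2S. For part (2), the same argument makes L_V g a constant multiple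
of g. Semisymmetry implies Ricci-semisymmetry by taking a trace, and the algebraic step applied to S
gives S = c g with c a function. Schur's lemma makes c constant, the dimension being odd and hence
not 2.

The definitions evaluate tensors at a point through local extensions. The proof works instead with
the C^∞(M)-module of global smooth fields, where the connection and curvature obey algebraic
identities. Cutoffs, local orthonormal frames and C^∞-linearity translate between the two. -/

set_option linter.unusedSectionVars false

namespace FKenmotsu

/-! ### Global smooth fields with prescribed germs, and local orthonormal frames -/

section Frames

variable {E : Type*} [NormedAddCommGroup E] [NormedSpace ℝ E] [FiniteDimensional ℝ E]
  {H : Type*} [TopologicalSpace H] {I : ModelWithCorners ℝ E H}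
  {M : Type*} [TopologicalSpace M] [ChartedSpace H M] [IsManifold I ∞ M]

variable (I M) in
/-- The smooth vector fields on `M`. -/
abbrev SmoothField := ContMDiffSection I E ∞ (fun x : M ↦ TangentSpace I x)

variable (I M) in
/-- The smooth real functions on `M`. -/
abbrev SmoothFun := ContMDiffMap I 𝓘(ℝ) M ℝ ∞

theorem exists_smoothFun_eventuallyEq_one [T2Space M] {x : M} {U : Set M} (hU : U ∈ 𝓝 x) :
    ∃ χ : SmoothFun I M, (∀ᶠ y in 𝓝 x, χ y = 1) ∧ tsupport χ ⊆ U := by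
  obtain ⟨χ, -, hχ⟩ := (SmoothBumpFunction.nhds_basis_tsupport (I := I) x).mem_iff.1 hU
  exact ⟨⟨χ, χ.contMDiff⟩, χ.eventuallyEq_one, hχ⟩

/-- A cutoff makes a local field global without changing its germ at x, so brackets and covariant
derivatives at x are unaffected. -/
theorem exists_smoothField_eventuallyEq [T2Space M] {x : M} {U : Set M} (hU : U ∈ 𝓝 x)
    {X : Π x : M, TangentSpace I x} (hX : CMDiff[U] ∞ (T% X)) :
    ∃ Y : SmoothField I M, ∀ᶠ y in 𝓝 x, Y y = X y := by
  obtain ⟨U', hU'U, hU', hxU'⟩ := mem_nhds_iff.1 hU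
  obtain ⟨χ, hχ, hχU⟩ := exists_smoothFun_eventuallyEq_one (I := I) (hU'.mem_nhds hxU')
  refine ⟨⟨(χ : M → ℝ) • X, ContMDiffOn.smul_section_of_tsupport χ.contMDiff.contMDiffOn hU' hχU
    (hX.mono hU'U)⟩, hχ.mono fun y hy ↦ ?_⟩
  change χ y • X y = X y
  rw [hy, one_smul]

theorem exists_smoothField_eventuallyEq_extend [T2Space M] {x : M} (u : TangentSpace I x) :
    ∃ X : SmoothField I M, X x = u ∧ ∀ᶠ y in 𝓝 x, FiberBundle.extend E u y = X y := by
  obtain ⟨U, hU, hu⟩ := FiberBundle.exists_contMDiffOn_extend (k := ∞) I E u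
  obtain ⟨X, hX⟩ := exists_smoothField_eventuallyEq hU hu
  exact ⟨X, by simpa using hX.self_of_nhds, hX.mono fun y hy ↦ hy.symm⟩

theorem exists_smoothField_apply_eq [T2Space M] {x : M} (u : TangentSpace I x) :
    ∃ X : SmoothField I M, X x = u :=
  (exists_smoothField_eventuallyEq_extend u).imp fun _ h ↦ h.1

variable [RiemannianBundle (fun x : M ↦ TangentSpace I x)]
  [IsContMDiffRiemannianBundle I ∞ E (fun x : M ↦ TangentSpace I x)]

theorem contMDiffOn_inner {X Y : Π x : M, TangentSpace I x} {U : Set M}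
    (hX : CMDiff[U] ∞ (T% X)) (hY : CMDiff[U] ∞ (T% Y)) :
    CMDiff[U] ∞ (fun x ↦ inner ℝ (X x) (Y x)) :=
  ContMDiffOn.inner_bundle (F := E) (E := fun x : M ↦ TangentSpace I x) (b := fun y ↦ y)
    (IB := I) hX hY

/-- Induction along the Gram–Schmidt recursion: each projection coefficient is a quotient of smooth
functions, whose denominator is nonzero by linear independence. -/
theorem contMDiffOn_gramSchmidt {m : ℕ} {s : Fin m → Π x : M, TangentSpace I x} {U : Set M}
    (hs : ∀ i, CMDiff[U] ∞ (T% (s i)))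
    (hlin : ∀ x ∈ U, LinearIndependent ℝ fun i ↦ s i x) (i : Fin m) :
    CMDiff[U] ∞ (T% (fun x ↦ InnerProductSpace.gramSchmidt ℝ (fun j ↦ s j x) i)) := by
  induction i using WellFoundedLT.induction with
  | _ i ih =>
    simp only [InnerProductSpace.gramSchmidt_def ℝ _ i, Submodule.starProjection_singleton]
    refine (hs i).sub_section (.sum_section fun j hj ↦ ?_)
    have hj := ih j (Finset.mem_Iio.1 hj)
    refine ContMDiffOn.smul_section ?_ hj
    simp only [RCLike.ofReal_real_eq_id, id_eq, ← real_inner_self_eq_norm_sq]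
    refine (contMDiffOn_inner hj (hs i)).div₀ (contMDiffOn_inner hj hj) fun x hx ↦ ?_
    exact inner_self_ne_zero.2 (InnerProductSpace.gramSchmidt_ne_zero j (hlin x hx))

theorem contMDiffOn_gramSchmidtNormed {m : ℕ} {s : Fin m → Π x : M, TangentSpace I x} {U : Set M}
    (hs : ∀ i, CMDiff[U] ∞ (T% (s i)))
    (hlin : ∀ x ∈ U, LinearIndependent ℝ fun i ↦ s i x) (i : Fin m) :
    CMDiff[U] ∞ (T% (fun x ↦ InnerProductSpace.gramSchmidtNormed ℝ (fun j ↦ s j x) i)) := by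
  have h := contMDiffOn_gramSchmidt hs hlin i
  have hpos : ∀ x ∈ U, inner ℝ (InnerProductSpace.gramSchmidt ℝ (fun j ↦ s j x) i)
      (InnerProductSpace.gramSchmidt ℝ (fun j ↦ s j x) i) ≠ 0 := fun x hx ↦
    inner_self_ne_zero.2 (InnerProductSpace.gramSchmidt_ne_zero i (hlin x hx))
  refine ContMDiffOn.smul_section (ContMDiffOn.inv₀ ?_ fun x hx ↦ ?_) h
  · refine ContMDiffOn.congr (f := fun x ↦ √(inner ℝ
      (InnerProductSpace.gramSchmidt ℝ (fun j ↦ s j x) i)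
      (InnerProductSpace.gramSchmidt ℝ (fun j ↦ s j x) i))) (fun x hx ↦ ?_)
      fun x hx ↦ by rw [RCLike.ofReal_real_eq_id]; exact norm_eq_sqrt_real_inner _
    exact (Real.contDiffAt_sqrt (hpos x hx)).contMDiffAt.comp_contMDiffWithinAt x
      (contMDiffOn_inner h h x hx)
  · simpa using InnerProductSpace.gramSchmidt_ne_zero i (hlin x hx)

/-- Gram–Schmidt is applied to the frame of a trivialization and the result is cut off. The fields
are global, but orthonormal only near x. -/
theorem exists_orthonormal_frame [T2Space M] (x : M) :
    ∃ e : Fin (Module.finrank ℝ E) → SmoothField I M,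
      ∀ᶠ y in 𝓝 x, Orthonormal ℝ fun i ↦ e i y := by
  let t := trivializationAt E (fun x : M ↦ TangentSpace I x) x
  let b := Module.finBasis ℝ E
  have ht := t.isLocalFrameOn_localFrame_baseSet I ∞ b
  have hU : t.baseSet ∈ 𝓝 x :=
    t.open_baseSet.mem_nhds (FiberBundle.mem_baseSet_trivializationAt' x)
  have hli : ∀ y ∈ t.baseSet, LinearIndependent ℝ fun i ↦ t.localFrame b i y :=
    fun y hy ↦ ht.linearIndependent hy
  choose e he using fun i ↦ exists_smoothField_eventuallyEq hU
    (contMDiffOn_gramSchmidtNormed ht.contMDiffOn hli i)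
  refine ⟨e, ?_⟩
  filter_upwards [hU, Filter.eventually_all.2 he] with y hy hey
  simpa only [hey] using InnerProductSpace.gramSchmidtNormed_orthonormal (hli y hy)

end Frames

/-! ### Derivative, bracket, metric and connection on the module of smooth fields -/

section Calculus

variable {E : Type*} [NormedAddCommGroup E] [NormedSpace ℝ E] [FiniteDimensional ℝ E]
  {H : Type*} [TopologicalSpace H] {I : ModelWithCorners ℝ E H}
  {M : Type*} [TopologicalSpace M] [ChartedSpace H M] [IsManifold I ∞ M]

namespace SmoothField

noncomputable instance : SMul (SmoothFun I M) (SmoothField I M) where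
  smul f X := ⟨(f : M → ℝ) • (X : Π x : M, TangentSpace I x), f.contMDiff.smul_section X.contMDiff⟩

@[simp]
theorem smul_apply (f : SmoothFun I M) (X : SmoothField I M) (x : M) :
    (f • X) x = f x • X x := rfl

@[simp]
theorem add_apply (X Y : SmoothField I M) (x : M) : (X + Y) x = X x + Y x := rfl

@[simp]
theorem sub_apply (X Y : SmoothField I M) (x : M) : (X - Y) x = X x - Y x := rfl

noncomputable instance : Module (SmoothFun I M) (SmoothField I M) where
  one_smul X := by ext x; exact one_smul ℝ (X x)
  mul_smul f g X := by ext x; exact mul_smul (f x) (g x) (X x)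
  smul_zero f := by ext x; exact smul_zero (f x)
  smul_add f X Y := by ext x; exact smul_add (f x) (X x) (Y x)
  add_smul f g X := by ext x; exact add_smul (f x) (g x) (X x)
  zero_smul X := by ext x; exact zero_smul ℝ (X x)

/-- Evaluation at a point. -/
noncomputable def evalHom (x : M) : SmoothField I M →+ TangentSpace I x where
  toFun X := X x
  map_zero' := rfl
  map_add' _ _ := rfl

@[simp]
theorem sum_apply {ι : Type*} (s : Finset ι) (X : ι → SmoothField I M) (x : M) :
    (∑ i ∈ s, X i) x = ∑ i ∈ s, X i x := map_sum (evalHom x) X s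

end SmoothField

namespace SmoothFun

@[simp]
theorem add_apply (f g : SmoothFun I M) (x : M) : (f + g) x = f x + g x := rfl

@[simp]
theorem sub_apply (f g : SmoothFun I M) (x : M) : (f - g) x = f x - g x := rfl

@[simp]
theorem neg_apply (f : SmoothFun I M) (x : M) : (-f) x = -f x := rfl

@[simp]
theorem mul_apply (f g : SmoothFun I M) (x : M) : (f * g) x = f x * g x := rfl

@[simp]
theorem zero_apply (x : M) : (0 : SmoothFun I M) x = 0 := rfl

@[simp]
theorem one_apply (x : M) : (1 : SmoothFun I M) x = 1 := rfl

@[simp]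
theorem sum_apply {ι : Type*} (s : Finset ι) (f : ι → SmoothFun I M) (x : M) :
    (∑ i ∈ s, f i) x = ∑ i ∈ s, f i x :=
  map_sum (ContMDiffMap.evalRingHom x : SmoothFun I M →+* ℝ) f s

theorem mdifferentiableAt (f : SmoothFun I M) (x : M) : MDiffAt (f : M → ℝ) x :=
  f.contMDiff.mdifferentiableAt (by simp)

end SmoothFun

theorem contMDiff_mvfderiv_apply (X : SmoothField I M) (f : SmoothFun I M) :
    CMDiff ∞ (fun x ↦ mvfderiv I f x (X x)) := by
  have h := (f.contMDiff.contMDiff_tangentMap (m := ∞) le_rfl).comp X.contMDiff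
  exact (contMDiff_snd_tangentBundle_modelSpace ℝ 𝓘(ℝ)).comp h

/-- The derivative of a smooth function along a smooth vector field. -/
noncomputable def dirDeriv (X : SmoothField I M) (f : SmoothFun I M) : SmoothFun I M :=
  ⟨fun x ↦ mvfderiv I f x (X x), contMDiff_mvfderiv_apply X f⟩

theorem dirDeriv_apply (X : SmoothField I M) (f : SmoothFun I M) (x : M) :
    dirDeriv X f x = mvfderiv I f x (X x) := rfl

theorem dirDeriv_add_left (X Y : SmoothField I M) (f : SmoothFun I M) :
    dirDeriv (X + Y) f = dirDeriv X f + dirDeriv Y f := by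
  ext x
  exact map_add (mvfderiv I f x) (X x) (Y x)

theorem dirDeriv_add (X : SmoothField I M) (f g : SmoothFun I M) :
    dirDeriv X (f + g) = dirDeriv X f + dirDeriv X g := by
  ext x
  exact congr($(mvfderiv_add (f.mdifferentiableAt x) (g.mdifferentiableAt x)) (X x))

theorem dirDeriv_mul (X : SmoothField I M) (f g : SmoothFun I M) :
    dirDeriv X (f * g) = f * dirDeriv X g + g * dirDeriv X f := by
  ext x
  exact congr($(mvfderiv_mul (f.mdifferentiableAt x) (g.mdifferentiableAt x)) (X x))

theorem minSmoothness_le_infty (k : ℕ) : minSmoothness ℝ (k : ℕ∞ω) ≤ ∞ := by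
  rw [minSmoothness_of_isRCLikeNormedField]
  exact mod_cast le_top

theorem contMDiff_mlieBracket (X Y : SmoothField I M) : CMDiff ∞ (T% (mlieBracket I X Y)) := by
  have : CompleteSpace E := FiniteDimensional.complete ℝ E
  have : IsManifold I ((⊤ : ℕ∞) + 1) M := ‹IsManifold I ∞ M›
  have : IsManifold I (minSmoothness ℝ 2) M := .of_le (n := ∞) (minSmoothness_le_infty 2)
  intro x
  exact ContMDiffAt.mlieBracket_vectorField (m := ⊤) (n := ⊤) X.contMDiff.contMDiffAt
    Y.contMDiff.contMDiffAt (by simp)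

/-- The Lie bracket of smooth vector fields. -/
noncomputable def lieBr (X Y : SmoothField I M) : SmoothField I M :=
  ⟨mlieBracket I X Y, contMDiff_mlieBracket X Y⟩

theorem lieBr_swap (X Y : SmoothField I M) : lieBr X Y = -lieBr Y X := by
  ext x
  exact mlieBracket_swap_apply

theorem lieBr_add_right (X Y Z : SmoothField I M) :
    lieBr X (Y + Z) = lieBr X Y + lieBr X Z := by
  have : CompleteSpace E := FiniteDimensional.complete ℝ E
  ext x
  exact mlieBracket_add_right Y.mdifferentiableAt Z.mdifferentiableAt

theorem lieBr_smul_right (f : SmoothFun I M) (X Y : SmoothField I M) :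
    lieBr X (f • Y) = dirDeriv X f • Y + f • lieBr X Y := by
  have : CompleteSpace E := FiniteDimensional.complete ℝ E
  ext x
  exact mlieBracket_smul_right (f.mdifferentiableAt x) Y.mdifferentiableAt

theorem lieBr_leibniz (X Y Z : SmoothField I M) :
    lieBr X (lieBr Y Z) = lieBr (lieBr X Y) Z + lieBr Y (lieBr X Z) := by
  have : CompleteSpace E := FiniteDimensional.complete ℝ E
  have : IsManifold I (minSmoothness ℝ 3) M := .of_le (n := ∞) (minSmoothness_le_infty 3)
  ext x
  exact leibniz_identity_mlieBracket_apply (X.contMDiff.of_le (minSmoothness_le_infty 2) x)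
    (Y.contMDiff.of_le (minSmoothness_le_infty 2) x) (Z.contMDiff.of_le (minSmoothness_le_infty 2) x)

variable [RiemannianBundle (fun x : M ↦ TangentSpace I x)]
  [IsContMDiffRiemannianBundle I ∞ E (fun x : M ↦ TangentSpace I x)]

theorem contMDiff_inner (X Y : SmoothField I M) : CMDiff ∞ (fun x ↦ inner ℝ (X x) (Y x)) :=
  contMDiffOn_univ.1 (contMDiffOn_inner X.contMDiff.contMDiffOn Y.contMDiff.contMDiffOn)

/-- The metric, as a pairing of smooth vector fields. -/
noncomputable def metric (X Y : SmoothField I M) : SmoothFun I M :=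
  ⟨fun x ↦ inner ℝ (X x) (Y x), contMDiff_inner X Y⟩

theorem metric_apply (X Y : SmoothField I M) (x : M) : metric X Y x = inner ℝ (X x) (Y x) := rfl

theorem metric_comm (X Y : SmoothField I M) : metric X Y = metric Y X := by
  ext x
  exact real_inner_comm (Y x) (X x)

theorem metric_add_left (X Y Z : SmoothField I M) :
    metric (X + Y) Z = metric X Z + metric Y Z := by
  ext x
  exact inner_add_left (X x) (Y x) (Z x)

theorem metric_smul_left (f : SmoothFun I M) (X Y : SmoothField I M) :
    metric (f • X) Y = f * metric X Y := by
  ext x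
  exact real_inner_smul_left (X x) (Y x) (f x)

theorem exists_orthonormalBasis_coe_eq {V ι : Type*} [NormedAddCommGroup V]
    [InnerProductSpace ℝ V] [FiniteDimensional ℝ V] [Fintype ι] {v : ι → V} (hv : Orthonormal ℝ v)
    (hι : Fintype.card ι = Module.finrank ℝ V) : ∃ b : OrthonormalBasis ι ℝ V, ⇑b = v :=
  ⟨.mk hv (hv.linearIndependent.span_eq_top_of_card_eq_finrank' hι).ge, by simp⟩

theorem exists_orthonormalBasis_frame {x : M}
    {e : Fin (Module.finrank ℝ E) → SmoothField I M} (he : Orthonormal ℝ fun i ↦ e i x) :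
    ∃ b : OrthonormalBasis (Fin (Module.finrank ℝ E)) ℝ (TangentSpace I x), ∀ i, b i = e i x := by
  have := finiteDimensional_tangentSpace (I := I) x
  obtain ⟨b, hb⟩ := exists_orthonormalBasis_coe_eq he
    ((Fintype.card_fin _).trans (show Module.finrank ℝ E = Module.finrank ℝ E from rfl))
  exact ⟨b, fun i ↦ congrFun hb i⟩

theorem sum_inner_frame_smul {x : M} {e : Fin (Module.finrank ℝ E) → SmoothField I M}
    (he : Orthonormal ℝ fun i ↦ e i x) (u : TangentSpace I x) :
    ∑ i, (inner ℝ (e i x) u) • e i x = u := by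
  obtain ⟨b, hb⟩ := exists_orthonormalBasis_frame he
  simpa only [← hb] using b.sum_repr' u

/-- Near each point W is the sum of its components in an orthonormal frame. This suits the Koszul
formula, which gives ∇_X Y only through its inner products. -/
theorem contMDiff_section_of_inner [T2Space M] {W : Π x : M, TangentSpace I x}
    (hW : ∀ Z : SmoothField I M, CMDiff ∞ (fun x ↦ inner ℝ (Z x) (W x))) : CMDiff ∞ (T% W) := by
  intro x
  obtain ⟨e, he⟩ := exists_orthonormal_frame (I := I) x
  have h : CMDiffAt ∞ (T% (fun y ↦ ∑ i, (inner ℝ (e i y) (W y)) • e i y)) x :=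
    .sum_section fun i _ ↦ (hW (e i) x).smul_section ((e i).contMDiff x)
  refine h.congr_of_eventuallyEq (he.mono fun y hy ↦ ?_)
  simp only [sum_inner_frame_smul hy]

theorem two_mul_inner_leviCivita_eq (X Y Z : SmoothField I M) (x : M) :
    2 * inner ℝ (leviCivita I M Y x (X x)) (Z x) =
      (dirDeriv X (metric Y Z) + dirDeriv Y (metric X Z) - dirDeriv Z (metric X Y)
        + metric (lieBr X Y) Z - metric (lieBr X Z) Y - metric (lieBr Y Z) X) x :=
  two_mul_inner_leviCivita Y.mdifferentiableAt X.mdifferentiableAt Z.mdifferentiableAt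

variable [T2Space M]

theorem contMDiff_leviCivita (X Y : SmoothField I M) :
    CMDiff ∞ (T% (fun x ↦ leviCivita I M Y x (X x))) := by
  refine contMDiff_section_of_inner fun Z ↦ ?_
  have h := contMDiff_const (c := (1 / 2 : ℝ)).mul
    (dirDeriv X (metric Y Z) + dirDeriv Y (metric X Z) - dirDeriv Z (metric X Y)
      + metric (lieBr X Y) Z - metric (lieBr X Z) Y - metric (lieBr Y Z) X).contMDiff
  refine h.congr fun x ↦ ?_
  rw [Pi.mul_apply, ← two_mul_inner_leviCivita_eq, real_inner_comm]
  ring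

/-- The covariant derivative `∇_X Y` of smooth vector fields. -/
noncomputable def nabla (X Y : SmoothField I M) : SmoothField I M :=
  ⟨fun x ↦ leviCivita I M Y x (X x), contMDiff_leviCivita X Y⟩

theorem nabla_apply (X Y : SmoothField I M) (x : M) :
    nabla X Y x = leviCivita I M Y x (X x) := rfl

theorem nabla_add_left (X Y Z : SmoothField I M) : nabla (X + Y) Z = nabla X Z + nabla Y Z := by
  ext x
  exact map_add (leviCivita I M Z x) (X x) (Y x)

theorem nabla_smul_left (f : SmoothFun I M) (X Y : SmoothField I M) :
    nabla (f • X) Y = f • nabla X Y := by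
  ext x
  exact map_smul (leviCivita I M Y x) (f x) (X x)

theorem nabla_add (X Y Z : SmoothField I M) : nabla X (Y + Z) = nabla X Y + nabla X Z := by
  ext x
  exact congr($((leviCivita I M).isCovariantDerivativeOnUniv.add (x := x) Y.mdifferentiableAt
    Z.mdifferentiableAt) (X x))

theorem nabla_smul (f : SmoothFun I M) (X Y : SmoothField I M) :
    nabla X (f • Y) = f • nabla X Y + dirDeriv X f • Y := by
  ext x
  exact congr($((leviCivita I M).isCovariantDerivativeOnUniv.leibniz (x := x) Y.mdifferentiableAt
    (f.mdifferentiableAt x)) (X x))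

theorem nabla_sub_nabla (X Y : SmoothField I M) : nabla X Y - nabla Y X = lieBr X Y := by
  ext x
  exact leviCivita_torsion X.mdifferentiableAt Y.mdifferentiableAt

theorem dirDeriv_metric (X Y Z : SmoothField I M) :
    dirDeriv X (metric Y Z) = metric (nabla X Y) Z + metric Y (nabla X Z) := by
  ext x
  exact leviCivita_metric X.mdifferentiableAt Y.mdifferentiableAt Z.mdifferentiableAt

end Calculus

/-! ### Algebraic and differential identities of the curvature -/

section Curvature

variable {E : Type*} [NormedAddCommGroup E] [NormedSpace ℝ E] [FiniteDimensional ℝ E]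
  {H : Type*} [TopologicalSpace H] {I : ModelWithCorners ℝ E H}
  {M : Type*} [TopologicalSpace M] [ChartedSpace H M] [IsManifold I ∞ M]

section LinearForms

variable (I M) in
/-- `dirDeriv`, bundled as a biadditive map. -/
noncomputable def dirDerivHom : SmoothField I M →+ SmoothFun I M →+ SmoothFun I M :=
  AddMonoidHom.mk' (fun X ↦ AddMonoidHom.mk' (dirDeriv X) (dirDeriv_add X))
    fun X Y ↦ AddMonoidHom.ext fun f ↦ dirDeriv_add_left X Y f

theorem dirDeriv_neg (X : SmoothField I M) (f : SmoothFun I M) :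
    dirDeriv X (-f) = -dirDeriv X f :=
  map_neg (dirDerivHom I M X) f

theorem dirDeriv_one (X : SmoothField I M) : dirDeriv X 1 = 0 := by
  simpa using dirDeriv_mul X 1 1

theorem lieBr_sub_right (X Y Z : SmoothField I M) : lieBr X (Y - Z) = lieBr X Y - lieBr X Z :=
  map_sub (AddMonoidHom.mk' (lieBr X) (lieBr_add_right X)) Y Z

theorem lieBr_add_left (X Y Z : SmoothField I M) : lieBr (X + Y) Z = lieBr X Z + lieBr Y Z := by
  rw [lieBr_swap, lieBr_add_right, lieBr_swap Z X, lieBr_swap Z Y]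
  abel

theorem lieBr_smul_left (f : SmoothFun I M) (X Y : SmoothField I M) :
    lieBr (f • X) Y = f • lieBr X Y - dirDeriv Y f • X := by
  rw [lieBr_swap, lieBr_smul_right, lieBr_swap Y X]
  module

variable [T2Space M]

/-- Expanding the Jacobi identity for X, Y and fZ by the Leibniz rule leaves the difference of the
two sides times Z, for every Z. -/
theorem dirDeriv_dirDeriv_sub (X Y : SmoothField I M) (f : SmoothFun I M) :
    dirDeriv X (dirDeriv Y f) - dirDeriv Y (dirDeriv X f) = dirDeriv (lieBr X Y) f := by
  have key (Z : SmoothField I M) :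
      (dirDeriv X (dirDeriv Y f) - dirDeriv Y (dirDeriv X f) - dirDeriv (lieBr X Y) f) • Z = 0 := by
    have h := lieBr_leibniz X Y (f • Z)
    simp only [lieBr_smul_right, lieBr_add_right, lieBr_leibniz X Y Z] at h
    linear_combination (norm := module) h
  ext x
  by_cases hx : ∃ u : TangentSpace I x, u ≠ 0
  · obtain ⟨u, hu⟩ := hx
    obtain ⟨Z, rfl⟩ := exists_smoothField_apply_eq u
    have h := congr($(key Z) x)
    exact sub_eq_zero.1 ((smul_eq_zero.1 h).resolve_right hu)
  -- If the tangent space is zero, no Z detects the coefficient, but then all directional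
  -- derivatives at x vanish.
  · push Not at hx
    simp only [SmoothFun.sub_apply, dirDeriv_apply, hx, map_zero, sub_zero]

end LinearForms

section Metric

variable [RiemannianBundle (fun x : M ↦ TangentSpace I x)]
  [IsContMDiffRiemannianBundle I ∞ E (fun x : M ↦ TangentSpace I x)]

variable (I M) in
/-- `metric`, bundled as a bilinear map. -/
noncomputable def metricHom :
    SmoothField I M →ₗ[SmoothFun I M] SmoothField I M →ₗ[SmoothFun I M] SmoothFun I M :=
  LinearMap.mk₂ _ metric metric_add_left metric_smul_left
    (fun X Y Z ↦ by simp only [metric_comm X, metric_add_left])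
    (fun f X Y ↦ by simp only [metric_comm X, metric_smul_left, smul_eq_mul])

theorem metric_add_right (X Y Z : SmoothField I M) : metric X (Y + Z) = metric X Y + metric X Z :=
  map_add (metricHom I M X) Y Z

theorem metric_sub_right (X Y Z : SmoothField I M) : metric X (Y - Z) = metric X Y - metric X Z :=
  map_sub (metricHom I M X) Y Z

theorem metric_neg_right (X Y : SmoothField I M) : metric X (-Y) = -metric X Y :=
  map_neg (metricHom I M X) Y

theorem metric_smul_right (f : SmoothFun I M) (X Y : SmoothField I M) :
    metric X (f • Y) = f * metric X Y :=
  map_smul (metricHom I M X) f Y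

theorem metric_sub_left (X Y Z : SmoothField I M) : metric (X - Y) Z = metric X Z - metric Y Z := by
  simp only [metric_comm _ Z, metric_sub_right]

theorem metric_neg_left (X Y : SmoothField I M) : metric (-X) Y = -metric X Y := by
  simp only [metric_comm _ Y, metric_neg_right]

variable [T2Space M]

variable (I M) in
/-- `nabla`, bundled as a biadditive map. -/
noncomputable def nablaHom : SmoothField I M →+ SmoothField I M →+ SmoothField I M :=
  AddMonoidHom.mk' (fun X ↦ AddMonoidHom.mk' (nabla X) (nabla_add X))
    fun X Y ↦ AddMonoidHom.ext fun Z ↦ nabla_add_left X Y Z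

theorem nabla_sub_left (X Y Z : SmoothField I M) : nabla (X - Y) Z = nabla X Z - nabla Y Z :=
  congr($(map_sub (nablaHom I M) X Y) Z)

theorem nabla_neg_left (X Y : SmoothField I M) : nabla (-X) Y = -nabla X Y :=
  congr($(map_neg (nablaHom I M) X) Y)

theorem nabla_zero_left (X : SmoothField I M) : nabla 0 X = 0 :=
  congr($(map_zero (nablaHom I M)) X)

theorem nabla_sub (X Y Z : SmoothField I M) : nabla X (Y - Z) = nabla X Y - nabla X Z :=
  map_sub (nablaHom I M X) Y Z

theorem nabla_neg (X Y : SmoothField I M) : nabla X (-Y) = -nabla X Y :=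
  map_neg (nablaHom I M X) Y

/-- The curvature `R(X, Y)Z` of smooth vector fields. -/
noncomputable def curv (X Y Z : SmoothField I M) : SmoothField I M :=
  nabla X (nabla Y Z) - nabla Y (nabla X Z) - nabla (lieBr X Y) Z

theorem curv_swap (X Y Z : SmoothField I M) : curv X Y Z = -curv Y X Z := by
  rw [curv, curv, lieBr_swap, nabla_neg_left]
  abel

theorem curv_add (X Y Z W : SmoothField I M) : curv X Y (Z + W) = curv X Y Z + curv X Y W := by
  simp only [curv, nabla_add]
  abel

theorem curv_smul (f : SmoothFun I M) (X Y Z : SmoothField I M) :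
    curv X Y (f • Z) = f • curv X Y Z := by
  simp only [curv, nabla_smul, nabla_add, ← dirDeriv_dirDeriv_sub X Y f]
  module

theorem curv_add_left (X Y Z W : SmoothField I M) : curv (X + Y) Z W = curv X Z W + curv Y Z W := by
  simp only [curv, nabla_add, nabla_add_left, lieBr_add_left]
  abel

theorem curv_smul_left (f : SmoothFun I M) (X Y Z : SmoothField I M) :
    curv (f • X) Y Z = f • curv X Y Z := by
  simp only [curv, nabla_smul, nabla_smul_left, nabla_sub_left, lieBr_smul_left]
  module

theorem curv_add_mid (X Y Z W : SmoothField I M) : curv X (Y + Z) W = curv X Y W + curv X Z W := by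
  simp only [curv_swap X, curv_add_left, neg_add]

theorem curv_smul_mid (f : SmoothFun I M) (X Y Z : SmoothField I M) :
    curv X (f • Y) Z = f • curv X Y Z := by
  simp only [curv_swap X, curv_smul_left, smul_neg]

/-- The curvature operator `R(X, Y)`, bundled as a linear map. -/
noncomputable def curvHom (X Y : SmoothField I M) :
    SmoothField I M →ₗ[SmoothFun I M] SmoothField I M where
  toFun := curv X Y
  map_add' := curv_add X Y
  map_smul' f := curv_smul f X Y

/-- The map `X ↦ R(X, Y)Z`, bundled as a linear map. -/
noncomputable def curvHomLeft (Y Z : SmoothField I M) :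
    SmoothField I M →ₗ[SmoothFun I M] SmoothField I M where
  toFun X := curv X Y Z
  map_add' X X' := curv_add_left X X' Y Z
  map_smul' f X := curv_smul_left f X Y Z

theorem curv_sub_left (X Y Z W : SmoothField I M) : curv (X - Y) Z W = curv X Z W - curv Y Z W :=
  map_sub (curvHomLeft Z W) X Y

/-- The first Bianchi identity. -/
theorem curv_cyclic (X Y Z : SmoothField I M) : curv X Y Z + curv Y Z X + curv Z X Y = 0 := by
  have h (A B C : SmoothField I M) :
      nabla A (nabla B C) - nabla A (nabla C B) = nabla (lieBr B C) A + lieBr A (lieBr B C) := by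
    rw [← nabla_sub, nabla_sub_nabla, ← nabla_sub_nabla A, add_sub_cancel]
  have hj := lieBr_leibniz X Y Z
  rw [lieBr_swap (lieBr X Y), lieBr_swap X Z, ← zero_sub (lieBr Z X), lieBr_sub_right,
    show lieBr Y 0 = 0 from map_zero (AddMonoidHom.mk' (lieBr Y) (lieBr_add_right Y))] at hj
  have h1 := h X Y Z
  have h2 := h Y Z X
  have h3 := h Z X Y
  simp only [curv]
  linear_combination (norm := module) h1 + h2 + h3 + hj

/-- The commutator of derivatives, applied to the function g(Z,W), is expanded by metric
compatibility. -/
theorem metric_curv_swap (X Y Z W : SmoothField I M) :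
    metric (curv X Y Z) W = -metric (curv X Y W) Z := by
  have h := dirDeriv_dirDeriv_sub X Y (metric Z W)
  simp only [dirDeriv_metric, dirDeriv_add] at h
  rw [metric_comm (curv X Y W)]
  simp only [curv, metric_sub_left, metric_sub_right]
  linear_combination h

/-- The octahedron argument: four instances of the first Bianchi identity, combined through the
antisymmetries in each pair. -/
theorem metric_curv_pair (X Y Z W : SmoothField I M) :
    metric (curv X Y Z) W = metric (curv Z W X) Y := by
  have b (A B C D : SmoothField I M) :
      metric (curv A B C) D + metric (curv B C A) D + metric (curv C A B) D = 0 := by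
    rw [← metric_add_left, ← metric_add_left, curv_cyclic]
    exact LinearMap.map_zero₂ (metricHom I M) D
  have s (A B C D : SmoothField I M) : metric (curv A B C) D = -metric (curv B A C) D := by
    rw [curv_swap, metric_neg_left]
  have h1 := b Z X Y W
  have h2 := b X Y W Z
  have h3 := b Y W Z X
  have h4 := b W Z X Y
  have e1 := metric_curv_swap Z X Y W
  have e2 := metric_curv_swap X Y W Z
  have e3 := metric_curv_swap Y W X Z
  have e4 := metric_curv_swap Y Z W X
  have e5 := metric_curv_swap W X Z Y
  have e6 := metric_curv_swap W Z X Y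
  have e7 := s Z Y W X
  have e8 := s X W Z Y
  have e9 := s W Z X Y
  -- The argument gives twice the difference; the factor 2 is removed below on real values.
  have key : metric (curv X Y Z) W - metric (curv Z W X) Y
      + (metric (curv X Y Z) W - metric (curv Z W X) Y) = 0 := by
    grind
  ext x
  have := congr($key x)
  simp only [SmoothFun.add_apply, SmoothFun.sub_apply, SmoothFun.zero_apply] at this
  linarith

/-- The covariant derivative `(∇_X R)(Y, Z)W` of the curvature. -/
noncomputable def covCurv (X Y Z W : SmoothField I M) : SmoothField I M :=
  nabla X (curv Y Z W) - curv (nabla X Y) Z W - curv Y (nabla X Z) W - curv Y Z (nabla X W)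

/-- The second Bianchi identity. -/
theorem covCurv_cyclic (X Y Z W : SmoothField I M) :
    covCurv X Y Z W + covCurv Y Z X W + covCurv Z X Y W = 0 := by
  have h (A B C : SmoothField I M) :
      curv (nabla A B) C W + curv C (nabla B A) W = curv (lieBr A B) C W := by
    rw [curv_swap C, ← nabla_sub_nabla, curv_sub_left, sub_eq_add_neg]
  have hj := lieBr_leibniz X Y Z
  have h1 := h X Y Z
  have h2 := h Y Z X
  have h3 := h Z X Y
  have hj : nabla (lieBr (lieBr X Y) Z) W + nabla (lieBr (lieBr Y Z) X) W
      + nabla (lieBr (lieBr Z X) Y) W = 0 := by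
    rw [← nabla_add_left, ← nabla_add_left, lieBr_swap (lieBr Y Z), lieBr_swap (lieBr Z X), hj,
      lieBr_swap X Z, ← zero_sub (lieBr Z X), lieBr_sub_right,
      show lieBr Y 0 = 0 from map_zero (AddMonoidHom.mk' (lieBr Y) (lieBr_add_right Y))]
    convert nabla_zero_left W using 2
    abel
  -- In the cyclic sum the third-order terms cancel, the curvature terms cancel against `h1`, `h2`,
  -- `h3` by torsion-freeness, and the double brackets vanish by Jacobi.
  have hd (A B C : SmoothField I M) : nabla A (curv B C W) - curv B C (nabla A W)
      = nabla A (nabla B (nabla C W)) - nabla A (nabla C (nabla B W))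
        - nabla B (nabla C (nabla A W)) + nabla C (nabla B (nabla A W))
        + curv (lieBr B C) A W + nabla (lieBr (lieBr B C) A) W := by
    simp only [curv, nabla_sub]
    abel
  have d1 := hd X Y Z
  have d2 := hd Y Z X
  have d3 := hd Z X Y
  simp only [covCurv]
  linear_combination (norm := module) d1 + d2 + d3 - h1 - h2 - h3 + hj

end Metric

end Curvature

/-! ### C^∞-linearity, and the passage between pointwise tensors and operations on fields -/

section Tensoriality

variable {E : Type*} [NormedAddCommGroup E] [NormedSpace ℝ E] [FiniteDimensional ℝ E]
  {H : Type*} [TopologicalSpace H] {I : ModelWithCorners ℝ E H}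
  {M : Type*} [TopologicalSpace M] [ChartedSpace H M] [IsManifold I ∞ M] [T2Space M]
  [RiemannianBundle (fun x : M ↦ TangentSpace I x)]
  [IsContMDiffRiemannianBundle I ∞ E (fun x : M ↦ TangentSpace I x)]

/-- The cutoff is supported where the frame is orthonormal, so the frame expansion becomes a global
identity to which a C^∞-linear map can be applied. -/
theorem exists_smul_eq_sum_frame (x : M) :
    ∃ (χ : SmoothFun I M) (e : Fin (Module.finrank ℝ E) → SmoothField I M), χ x = 1 ∧
      ∀ X : SmoothField I M, χ • X = ∑ i, (χ * metric (e i) X) • e i := by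
  obtain ⟨e, he⟩ := exists_orthonormal_frame (I := I) x
  obtain ⟨χ, hχ, hχU⟩ := exists_smoothFun_eventuallyEq_one (I := I) he
  refine ⟨χ, e, hχ.self_of_nhds, fun X ↦ ?_⟩
  ext y
  rw [SmoothField.sum_apply]
  by_cases hy : χ y = 0
  · simp [hy]
  · have hon : Orthonormal ℝ fun i ↦ e i y := hχU (subset_tsupport _ hy)
    simp only [SmoothField.smul_apply, metric_apply, mul_smul,
      ← Finset.smul_sum, sum_inner_frame_smul hon]

/-- A `C^∞`-linear operation on smooth vector fields only depends on the value at the point. -/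
theorem apply_linear_eq_of_apply_eq {N V : Type*} [AddCommGroup N] [Module (SmoothFun I M) N]
    [AddCommGroup V] [Module ℝ V] {x : M} (ev : N →+ V)
    (hev : ∀ (f : SmoothFun I M) (n : N), ev (f • n) = f x • ev n)
    (T : SmoothField I M →ₗ[SmoothFun I M] N) {X Y : SmoothField I M} (h : X x = Y x) :
    ev (T X) = ev (T Y) := by
  obtain ⟨χ, e, hχ, he⟩ := exists_smul_eq_sum_frame (I := I) x
  have key (Z : SmoothField I M) : ev (T Z) = ∑ i, (inner ℝ (e i x) (Z x)) • ev (T (e i)) := by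
    have hZ := congrArg (fun W ↦ ev (T W)) (he Z)
    simpa only [map_smul, map_sum, hev, hχ, one_smul, SmoothFun.mul_apply, one_mul,
      metric_apply] using hZ
  rw [key, key, h]

theorem field_linear_apply_eq (T : SmoothField I M →ₗ[SmoothFun I M] SmoothField I M) {x : M}
    {X Y : SmoothField I M} (h : X x = Y x) : T X x = T Y x :=
  apply_linear_eq_of_apply_eq (SmoothField.evalHom x) (fun _ _ ↦ rfl) T h

theorem fun_linear_apply_eq (T : SmoothField I M →ₗ[SmoothFun I M] SmoothFun I M) {x : M}
    {X Y : SmoothField I M} (h : X x = Y x) : T X x = T Y x :=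
  apply_linear_eq_of_apply_eq
    (ContMDiffMap.evalRingHom x : SmoothFun I M →+* ℝ).toAddMonoidHom (fun _ _ ↦ rfl) T h

theorem mdifferentiableAt_of_eventuallyEq {X : SmoothField I M} {X' : Π x : M, TangentSpace I x}
    {x : M} (h : ∀ᶠ y in 𝓝 x, X' y = X y) : MDiffAt (T% X') x :=
  X.mdifferentiableAt.congr_of_eventuallyEq (h.mono fun y hy ↦ by simp only [hy])

theorem leviCivita_apply_of_eventuallyEq {X : SmoothField I M} {X' : Π x : M, TangentSpace I x}
    {x : M} (h : ∀ᶠ y in 𝓝 x, X' y = X y) : leviCivita I M X' x = leviCivita I M X x :=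
  (leviCivita I M).isCovariantDerivativeOnUniv.congr_of_eventuallyEq
    (mdifferentiableAt_of_eventuallyEq h) X.mdifferentiableAt Filter.univ_mem h

/-- Curvature differentiates twice, so the inner covariant derivatives have to agree on a
neighbourhood and not just at x. -/
theorem leviCivita_eventuallyEq_nabla {X Y : SmoothField I M} {X' Y' : Π x : M, TangentSpace I x}
    {x : M} (hX : ∀ᶠ y in 𝓝 x, X' y = X y) (hY : ∀ᶠ y in 𝓝 x, Y' y = Y y) :
    ∀ᶠ y in 𝓝 x, leviCivita I M Y' y (X' y) = nabla X Y y := by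
  filter_upwards [hX, hY.eventually_nhds] with y hXy hYy
  rw [leviCivita_apply_of_eventuallyEq hYy, hXy, nabla_apply]

/-- The chosen extensions are replaced by global fields with the same germs; C^∞-linearity in each
slot then allows any fields with the same values at x. -/
theorem curvature_apply (X Y Z : SmoothField I M) (x : M) :
    curvature (X x) (Y x) (Z x) = curv X Y Z x := by
  obtain ⟨X', hX, hX'⟩ := exists_smoothField_eventuallyEq_extend (X x)
  obtain ⟨Y', hY, hY'⟩ := exists_smoothField_eventuallyEq_extend (Y x)
  obtain ⟨Z', hZ, hZ'⟩ := exists_smoothField_eventuallyEq_extend (Z x)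
  have h1 : curvature (X x) (Y x) (Z x) = curv X' Y' Z' x := by
    simp only [curvature]
    rw [leviCivita_apply_of_eventuallyEq (leviCivita_eventuallyEq_nabla hY' hZ'),
      leviCivita_apply_of_eventuallyEq (leviCivita_eventuallyEq_nabla hX' hZ'),
      leviCivita_apply_of_eventuallyEq hZ', hX'.self_of_nhds, hY'.self_of_nhds,
      Filter.EventuallyEq.mlieBracket_vectorField_eq hX' hY']
    rfl
  have h2 : curv X' Y' Z' x = curv X Y' Z' x := field_linear_apply_eq (curvHomLeft Y' Z') hX
  have h3 : curv X Y' Z' x = curv X Y Z' x := by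
    rw [curv_swap, curv_swap X Y]
    exact congrArg Neg.neg (field_linear_apply_eq (curvHomLeft X Z') hY)
  rw [h1, h2, h3]
  exact field_linear_apply_eq (curvHom X Y) hZ

/-- The map `u ↦ R(u, v)w` on the tangent space. -/
noncomputable def curvatureLeft {x : M} (v w : TangentSpace I x) :
    TangentSpace I x →ₗ[ℝ] TangentSpace I x where
  toFun u := curvature u v w
  map_add' u u' := by
    obtain ⟨X, rfl⟩ := exists_smoothField_apply_eq u
    obtain ⟨X', rfl⟩ := exists_smoothField_apply_eq u'
    obtain ⟨Y, rfl⟩ := exists_smoothField_apply_eq v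
    obtain ⟨Z, rfl⟩ := exists_smoothField_apply_eq w
    rw [← SmoothField.add_apply, curvature_apply, curvature_apply, curvature_apply, curv_add_left,
      SmoothField.add_apply]
  map_smul' c u := by
    obtain ⟨X, rfl⟩ := exists_smoothField_apply_eq u
    obtain ⟨Y, rfl⟩ := exists_smoothField_apply_eq v
    obtain ⟨Z, rfl⟩ := exists_smoothField_apply_eq w
    let f : SmoothFun I M := ⟨fun _ ↦ c, contMDiff_const⟩
    have h : c • X x = (f • X) x := rfl
    rw [h, curvature_apply, curvature_apply, curv_smul_left]
    rfl

/-- The map `w ↦ R(u, v)w` on the tangent space. -/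
noncomputable def curvatureRight {x : M} (u v : TangentSpace I x) :
    TangentSpace I x →ₗ[ℝ] TangentSpace I x where
  toFun w := curvature u v w
  map_add' w w' := by
    obtain ⟨X, rfl⟩ := exists_smoothField_apply_eq u
    obtain ⟨Y, rfl⟩ := exists_smoothField_apply_eq v
    obtain ⟨Z, rfl⟩ := exists_smoothField_apply_eq w
    obtain ⟨Z', rfl⟩ := exists_smoothField_apply_eq w'
    rw [← SmoothField.add_apply, curvature_apply, curvature_apply, curvature_apply, curv_add,
      SmoothField.add_apply]
  map_smul' c w := by
    obtain ⟨X, rfl⟩ := exists_smoothField_apply_eq u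
    obtain ⟨Y, rfl⟩ := exists_smoothField_apply_eq v
    obtain ⟨Z, rfl⟩ := exists_smoothField_apply_eq w
    let f : SmoothFun I M := ⟨fun _ ↦ c, contMDiff_const⟩
    have h : c • Z x = (f • Z) x := rfl
    rw [h, curvature_apply, curvature_apply, curv_smul]
    rfl

/-- The basis in the definition of `ricci` is chosen separately at each point. As a trace, the value
can be computed in a smooth frame, whence smoothness. -/
theorem ricci_eq_trace {x : M} (v w : TangentSpace I x) :
    ricci I M x v w = LinearMap.trace ℝ _ (curvatureLeft v w) := by
  have := finiteDimensional_tangentSpace (I := I) x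
  rw [LinearMap.trace_eq_sum_inner _ (stdOrthonormalBasis ℝ (TangentSpace I x))]
  simp only [ricci, curvatureLeft, LinearMap.coe_mk, AddHom.coe_mk]
  exact Finset.sum_congr rfl fun i _ ↦ real_inner_comm _ _

theorem ricci_apply_frame {x : M} {e : Fin (Module.finrank ℝ E) → SmoothField I M}
    (he : Orthonormal ℝ fun i ↦ e i x) (Y Z : SmoothField I M) :
    ricci I M x (Y x) (Z x) = (∑ i, metric (curv (e i) Y Z) (e i)) x := by
  obtain ⟨b, hb⟩ := exists_orthonormalBasis_frame he
  rw [ricci_eq_trace, LinearMap.trace_eq_sum_inner _ b, SmoothFun.sum_apply]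
  refine Finset.sum_congr rfl fun i _ ↦ ?_
  rw [hb i, metric_apply, ← curvature_apply, real_inner_comm]
  rfl

theorem contMDiff_ricci (Y Z : SmoothField I M) :
    CMDiff ∞ (fun x ↦ ricci I M x (Y x) (Z x)) := by
  intro x
  obtain ⟨e, he⟩ := exists_orthonormal_frame (I := I) x
  exact ((∑ i, metric (curv (e i) Y Z) (e i)).contMDiff x).congr_of_eventuallyEq
    (he.mono fun y hy ↦ ricci_apply_frame hy Y Z)

/-- The Ricci tensor, as a pairing of smooth vector fields. -/
noncomputable def ric (Y Z : SmoothField I M) : SmoothFun I M :=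
  ⟨fun x ↦ ricci I M x (Y x) (Z x), contMDiff_ricci Y Z⟩

theorem ric_apply (Y Z : SmoothField I M) (x : M) : ric Y Z x = ricci I M x (Y x) (Z x) := rfl

theorem ric_apply_frame {x : M} {e : Fin (Module.finrank ℝ E) → SmoothField I M}
    (he : Orthonormal ℝ fun i ↦ e i x) (Y Z : SmoothField I M) :
    ric Y Z x = (∑ i, metric (curv (e i) Y Z) (e i)) x :=
  ricci_apply_frame he Y Z

/-- Holds term by term in a frame, by pair symmetry and the two antisymmetries of R. -/
theorem ric_comm (Y Z : SmoothField I M) : ric Y Z = ric Z Y := by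
  ext x
  obtain ⟨e, he⟩ := exists_orthonormal_frame (I := I) x
  simp only [ric_apply_frame he.self_of_nhds]
  congr 1
  refine Finset.sum_congr rfl fun i _ ↦ ?_
  rw [metric_curv_pair, curv_swap, metric_neg_left, metric_curv_swap, neg_neg]

theorem ric_add_left (X Y Z : SmoothField I M) : ric (X + Y) Z = ric X Z + ric Y Z := by
  ext x
  obtain ⟨e, he⟩ := exists_orthonormal_frame (I := I) x
  simp only [SmoothFun.add_apply, ric_apply_frame he.self_of_nhds, curv_add_mid, metric_add_left,
    Finset.sum_add_distrib]

theorem ric_smul_left (f : SmoothFun I M) (X Y : SmoothField I M) :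
    ric (f • X) Y = f * ric X Y := by
  ext x
  obtain ⟨e, he⟩ := exists_orthonormal_frame (I := I) x
  simp only [SmoothFun.mul_apply, ric_apply_frame he.self_of_nhds, curv_smul_mid, metric_smul_left,
    ← Finset.mul_sum]

variable (I M) in
/-- The space of `C^∞`-bilinear pairings of smooth vector fields, i.e. of smooth
`(0,2)`-tensor fields. -/
abbrev SmoothForm :=
  SmoothField I M →ₗ[SmoothFun I M] SmoothField I M →ₗ[SmoothFun I M] SmoothFun I M

variable (I M) in
/-- `ric`, bundled as a bilinear map. -/
noncomputable def ricHom : SmoothForm I M :=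
  LinearMap.mk₂ _ ric ric_add_left ric_smul_left
    (fun X Y Z ↦ by simp only [ric_comm X, ric_add_left])
    (fun f X Y ↦ by simp only [ric_comm X, ric_smul_left, smul_eq_mul])

/-- The Lie derivative of the metric, as a bilinear map on smooth vector fields. -/
noncomputable def lieDerivMetricHom (V : SmoothField I M) : SmoothForm I M :=
  LinearMap.mk₂ _ (fun X Y ↦ metric (nabla X V) Y + metric X (nabla Y V))
    (fun X X' Y ↦ by simp only [nabla_add_left, metric_add_left]; ring)
    (fun f X Y ↦ by simp only [nabla_smul_left, metric_smul_left, smul_eq_mul]; ring)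
    (fun X Y Y' ↦ by simp only [nabla_add_left, metric_add_right]; ring)
    (fun f X Y ↦ by simp only [nabla_smul_left, metric_smul_right, smul_eq_mul]; ring)

theorem lieDerivMetricHom_comm (V X Y : SmoothField I M) :
    lieDerivMetricHom V X Y = lieDerivMetricHom V Y X := by
  simp only [lieDerivMetricHom, LinearMap.mk₂_apply, metric_comm X, metric_comm Y]
  ring

/-- Substituting [V,X] = ∇_V X - ∇_X V cancels the ∇_V terms against the derivative of the metric.
-/
theorem lieDerivMetric_apply (V X Y : SmoothField I M) (x : M) :
    lieDerivMetric V x (X x) (Y x) = lieDerivMetricHom V X Y x := by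
  simp only [lieDerivMetric]
  have hX := FiberBundle.mdifferentiableAt_extend I E (X x)
  have hY := FiberBundle.mdifferentiableAt_extend I E (Y x)
  rw [leviCivita_metric V.mdifferentiableAt hX hY, ← leviCivita_torsion V.mdifferentiableAt hX,
    ← leviCivita_torsion V.mdifferentiableAt hY, FiberBundle.extend_apply_self,
    FiberBundle.extend_apply_self, inner_sub_left, inner_sub_right]
  change _ = inner ℝ (leviCivita I M V x (X x)) (Y x) + inner ℝ (X x) (leviCivita I M V x (Y x))
  ring

/-- The covariant derivative of a bilinear pairing of smooth vector fields. -/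
noncomputable def covDerivForm (A : SmoothForm I M) (X : SmoothField I M) : SmoothForm I M :=
  LinearMap.mk₂ _ (fun Y Z ↦ dirDeriv X (A Y Z) - A (nabla X Y) Z - A Y (nabla X Z))
    (fun Y Y' Z ↦ by
      simp only [map_add, LinearMap.add_apply, nabla_add, dirDeriv_add]; ring)
    (fun f Y Z ↦ by
      simp only [map_add, map_smul, LinearMap.add_apply, LinearMap.smul_apply, nabla_smul,
        smul_eq_mul, dirDeriv_mul]
      ring)
    (fun Y Z Z' ↦ by
      simp only [map_add, nabla_add, dirDeriv_add]; ring)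
    (fun f Y Z ↦ by
      simp only [map_add, map_smul, nabla_smul, smul_eq_mul, dirDeriv_mul]
      ring)

theorem covDerivForm_apply (A : SmoothForm I M) (X Y Z : SmoothField I M) :
    covDerivForm A X Y Z = dirDeriv X (A Y Z) - A (nabla X Y) Z - A Y (nabla X Z) := rfl

theorem form_apply_eq (A : SmoothForm I M) {x : M} {Y Y' Z Z' : SmoothField I M}
    (hY : Y x = Y' x) (hZ : Z x = Z' x) : A Y Z x = A Y' Z' x :=
  (fun_linear_apply_eq (A Y) hZ).trans (fun_linear_apply_eq (A.flip Z') hY)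

theorem covDerivTwoTensor_apply {α : Π x : M, TangentSpace I x → TangentSpace I x → ℝ}
    {A : SmoothForm I M} (hA : ∀ (Y Z : SmoothField I M) (x : M), A Y Z x = α x (Y x) (Z x))
    (X Y Z : SmoothField I M) (x : M) :
    covDerivTwoTensor α x (X x) (Y x) (Z x) = covDerivForm A X Y Z x := by
  obtain ⟨Y', hY, hY'⟩ := exists_smoothField_eventuallyEq_extend (Y x)
  obtain ⟨Z', hZ, hZ'⟩ := exists_smoothField_eventuallyEq_extend (Z x)
  have h : (fun y ↦ α y (FiberBundle.extend E (Y x) y) (FiberBundle.extend E (Z x) y))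
      =ᶠ[𝓝 x] A Y' Z' := by
    filter_upwards [hY', hZ'] with y hYy hZy
    rw [hYy, hZy, hA]
  rw [← form_apply_eq (covDerivForm A X) hY hZ]
  simp only [covDerivTwoTensor, mvfderiv, h.mfderiv_eq]
  rw [leviCivita_apply_of_eventuallyEq hY', leviCivita_apply_of_eventuallyEq hZ',
    hY'.self_of_nhds, hZ'.self_of_nhds]
  simp only [covDerivForm_apply, SmoothFun.sub_apply, hA]
  rfl

theorem covDerivForm_eq_zero_of_isParallel
    {α : Π x : M, TangentSpace I x → TangentSpace I x → ℝ}
    {A : SmoothForm I M} (hA : ∀ (Y Z : SmoothField I M) (x : M), A Y Z x = α x (Y x) (Z x))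
    (hα : IsParallel α) (X : SmoothField I M) : covDerivForm A X = 0 := by
  ext Y Z x
  rw [← covDerivTwoTensor_apply hA]
  exact hα _ _ _ _

/-- The Ricci identity for a parallel pairing. -/
theorem curv_form_eq_zero {A : SmoothForm I M} (hA : ∀ X, covDerivForm A X = 0)
    (X Y Z W : SmoothField I M) : A (curv X Y Z) W + A Z (curv X Y W) = 0 := by
  have h (X Y Z : SmoothField I M) : dirDeriv X (A Y Z) = A (nabla X Y) Z + A Y (nabla X Z) := by
    have h0 : covDerivForm A X Y Z = 0 := congr($(hA X) Y Z)
    rw [covDerivForm_apply] at h0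
    linear_combination h0
  -- Commuting two derivatives of the function A(Z,W) puts the curvature on each argument in turn.
  have hc := dirDeriv_dirDeriv_sub X Y (A Z W)
  simp only [h, dirDeriv_add] at hc
  simp only [curv, map_sub, LinearMap.sub_apply]
  linear_combination hc

end Tensoriality

/-! ### Functions with zero derivative on a connected manifold -/

section Constancy

variable {E : Type*} [NormedAddCommGroup E] [NormedSpace ℝ E]
  {H : Type*} [TopologicalSpace H] {I : ModelWithCorners ℝ E H} [I.Boundaryless]
  {M : Type*} [TopologicalSpace M] [ChartedSpace H M] [IsManifold I ∞ M]

theorem eventually_eq_of_mvfderiv_eq_zero {f : M → ℝ} (hf : CMDiff ∞ f)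
    (h : ∀ x, mvfderiv I f x = 0) (x : M) : ∀ᶠ y in 𝓝 x, f y = f x := by
  let φ := extChartAt I x
  -- Without boundary the chart target is open, so it contains a ball, which is convex.
  obtain ⟨r, hr, hball⟩ := Metric.isOpen_iff.1 (isOpen_extChartAt_target (I := I) x) (φ x)
    (mem_extChartAt_target x)
  have hd (z) (hz : z ∈ Metric.ball (φ x) r) :
      HasFDerivAt (f ∘ φ.symm) (0 : E →L[ℝ] ℝ) z := by
    have h1 : MDiffAt φ.symm z :=
      ((contMDiffOn_extChartAt_symm (n := ∞) x).contMDiffAt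
        ((isOpen_extChartAt_target x).mem_nhds (hball hz))).mdifferentiableAt (by simp)
    have h2 : MDiffAt f (φ.symm z) := (hf (φ.symm z)).mdifferentiableAt (by simp)
    have h3 := (h2.comp z h1).hasMFDerivAt.hasFDerivAt
    have h4 : mvfderiv 𝓘(ℝ, E) (f ∘ φ.symm) z = 0 := by
      rw [mvfderiv_comp z h2 h1, h]
      exact ContinuousLinearMap.zero_comp _
    exact h3.congr_fderiv h4
  have hconst (y) (hy : y ∈ Metric.ball (φ x) r) := (convex_ball (φ x) r).is_const_of_fderivWithin_eq_zero (𝕜 := ℝ)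
    (f := f ∘ φ.symm)
    (fun z hz ↦ (hd z hz).differentiableAt.differentiableWithinAt)
    (fun z hz ↦ (hd z hz).hasFDerivWithinAt.fderivWithin
      (Metric.isOpen_ball.uniqueDiffWithinAt hz)) hy
    (Metric.mem_ball_self hr)
  filter_upwards [extChartAt_source_mem_nhds (I := I) x,
    (continuousAt_extChartAt (I := I) x).preimage_mem_nhds (Metric.ball_mem_nhds _ hr)] with y hy hyr
  have := hconst _ hyr
  simpa only [Function.comp_apply, φ, extChartAt_to_inv, (extChartAt I x).left_inv hy] using this

theorem exists_eq_const_of_mvfderiv_eq_zero [PreconnectedSpace M] [Nonempty M] {f : M → ℝ}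
    (hf : CMDiff ∞ f) (h : ∀ x, mvfderiv I f x = 0) : ∃ c, ∀ x, f x = c := by
  have hl : IsLocallyConstant f :=
    (IsLocallyConstant.iff_eventually_eq f).2 (eventually_eq_of_mvfderiv_eq_zero hf h)
  exact ⟨f (Classical.arbitrary M), fun x ↦ hl.apply_eq_of_preconnectedSpace _ _⟩

end Constancy

/-! ### Traces of covariant derivatives and Schur's lemma -/

section Schur

variable {E : Type*} [NormedAddCommGroup E] [NormedSpace ℝ E] [FiniteDimensional ℝ E]
  {H : Type*} [TopologicalSpace H] {I : ModelWithCorners ℝ E H}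
  {M : Type*} [TopologicalSpace M] [ChartedSpace H M] [IsManifold I ∞ M] [T2Space M]
  [RiemannianBundle (fun x : M ↦ TangentSpace I x)]
  [IsContMDiffRiemannianBundle I ∞ E (fun x : M ↦ TangentSpace I x)]

theorem mvfderiv_eq_zero_of_dirDeriv_eq_zero {f : SmoothFun I M}
    (h : ∀ X, dirDeriv X f = 0) (x : M) : mvfderiv I f x = 0 := by
  ext u
  obtain ⟨X, rfl⟩ := exists_smoothField_apply_eq u
  exact congr($(h X) x)

theorem dirDeriv_apply_of_eventuallyEq {f g : SmoothFun I M} {x : M}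
    (h : ∀ᶠ y in 𝓝 x, f y = g y) (X : SmoothField I M) : dirDeriv X f x = dirDeriv X g x := by
  have h' : (f : M → ℝ) =ᶠ[𝓝 x] g := h
  simp only [dirDeriv_apply, mvfderiv, h'.mfderiv_eq]
  rfl

theorem dirDeriv_apply_of_eventuallyEq_const {f : SmoothFun I M} {c : ℝ} {x : M}
    (h : ∀ᶠ y in 𝓝 x, f y = c) (X : SmoothField I M) : dirDeriv X f x = 0 := by
  have hc : (f : M → ℝ) =ᶠ[𝓝 x] fun _ ↦ c := h
  rw [dirDeriv_apply, mvfderiv, hc.mfderiv_eq, mfderiv_const]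
  exact congr($(ContinuousLinearMap.comp_zero _) (X x))

theorem dirDeriv_metric_frame {x : M} {e : Fin (Module.finrank ℝ E) → SmoothField I M}
    (he : ∀ᶠ y in 𝓝 x, Orthonormal ℝ fun i ↦ e i y) (X : SmoothField I M)
    (i j : Fin (Module.finrank ℝ E)) : dirDeriv X (metric (e i) (e j)) x = 0 :=
  dirDeriv_apply_of_eventuallyEq_const (c := if i = j then 1 else 0)
    (he.mono fun y hy ↦ by
      rw [metric_apply]
      exact orthonormal_iff_ite.1 hy i j) X

theorem sum_metric_frame_smul_apply {x : M} {e : Fin (Module.finrank ℝ E) → SmoothField I M}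
    (he : Orthonormal ℝ fun i ↦ e i x) (X : SmoothField I M) :
    (∑ i, metric (e i) X • e i) x = X x := by
  rw [SmoothField.sum_apply]
  exact sum_inner_frame_smul he (X x)

/-- The connection coefficients g(∇_X e_i, e_j) of an orthonormal frame are skew in i and j, so the
double sum cancels under exchange of indices. -/
theorem sum_form_nabla_frame {x : M} {e : Fin (Module.finrank ℝ E) → SmoothField I M}
    (he : ∀ᶠ y in 𝓝 x, Orthonormal ℝ fun i ↦ e i y) (B : SmoothForm I M) (X : SmoothField I M) :
    ∑ i, (B (nabla X (e i)) (e i) x + B (e i) (nabla X (e i)) x) = 0 := by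
  have h1 (i) : B (nabla X (e i)) (e i) x
      = ∑ j, metric (e j) (nabla X (e i)) x * B (e j) (e i) x := by
    rw [← form_apply_eq B (sum_metric_frame_smul_apply he.self_of_nhds _) rfl]
    simp only [map_sum, map_smul, LinearMap.sum_apply, LinearMap.smul_apply, SmoothFun.sum_apply,
      smul_eq_mul, SmoothFun.mul_apply]
  have h2 (i) : B (e i) (nabla X (e i)) x
      = ∑ j, metric (e j) (nabla X (e i)) x * B (e i) (e j) x := by
    rw [← form_apply_eq B rfl (sum_metric_frame_smul_apply he.self_of_nhds _)]
    simp only [map_sum, map_smul, SmoothFun.sum_apply, smul_eq_mul, SmoothFun.mul_apply]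
  have h3 (i j) : metric (e j) (nabla X (e i)) x = -metric (e i) (nabla X (e j)) x := by
    have h := dirDeriv_metric_frame he X i j
    rw [dirDeriv_metric, SmoothFun.add_apply, metric_comm (nabla X (e i))] at h
    linarith
  simp only [h1, h2, Finset.sum_add_distrib]
  rw [Finset.sum_comm, ← Finset.sum_add_distrib]
  refine Finset.sum_eq_zero fun i _ ↦ ?_
  rw [← Finset.sum_add_distrib]
  refine Finset.sum_eq_zero fun j _ ↦ ?_
  rw [h3]
  ring

/-- Covariant differentiation commutes with the metric trace. -/
theorem sum_covDerivForm_frame {x : M} {e : Fin (Module.finrank ℝ E) → SmoothField I M}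
    (he : ∀ᶠ y in 𝓝 x, Orthonormal ℝ fun i ↦ e i y) (B : SmoothForm I M) (X : SmoothField I M) :
    ∑ i, covDerivForm B X (e i) (e i) x = dirDeriv X (∑ i, B (e i) (e i)) x := by
  have h : dirDeriv X (∑ i, B (e i) (e i)) = ∑ i, dirDeriv X (B (e i) (e i)) :=
    map_sum (dirDerivHom I M X) _ _
  have h0 := sum_form_nabla_frame he B X
  rw [Finset.sum_add_distrib] at h0
  simp only [h, covDerivForm_apply, SmoothFun.sub_apply, SmoothFun.sum_apply,
    Finset.sum_sub_distrib]
  linarith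

/-- The pairing `(X, W) ↦ g(R(X, Y)Z, W)`. -/
noncomputable def curvForm (Y Z : SmoothField I M) : SmoothForm I M :=
  (metricHom I M).comp (curvHomLeft Y Z)

theorem curvForm_apply (X Y Z W : SmoothField I M) :
    curvForm Y Z X W = metric (curv X Y Z) W := rfl

/-- Isolates the two slots that get traced: in these, ∇R is the derivative of a bilinear form, and
the other two slots only add correction terms. -/
theorem metric_covCurv (X Y Z W U : SmoothField I M) :
    metric (covCurv X Y Z W) U = covDerivForm (curvForm Z W) X Y U
      - metric (curv Y (nabla X Z) W) U - metric (curv Y Z (nabla X W)) U := by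
  rw [covDerivForm_apply, curvForm_apply, curvForm_apply, curvForm_apply, dirDeriv_metric, covCurv]
  simp only [metric_sub_left]
  ring

theorem covCurv_swap (X Y Z W : SmoothField I M) : covCurv X Y Z W = -covCurv X Z Y W := by
  rw [covCurv, covCurv, curv_swap Y Z, curv_swap (nabla X Y), curv_swap Y (nabla X Z),
    curv_swap Y Z, nabla_neg]
  abel

theorem metric_covCurv_swap (X Y Z W U : SmoothField I M) :
    metric (covCurv X Y Z W) U = -metric (covCurv X Y Z U) W := by
  have h := dirDeriv_metric X (curv Y Z W) U
  rw [metric_curv_swap, dirDeriv_neg, dirDeriv_metric, metric_curv_swap Y Z W (nabla X U)] at h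
  have h1 := metric_curv_swap Y Z (nabla X W) U
  have h2 := metric_curv_swap (nabla X Y) Z W U
  have h3 := metric_curv_swap Y (nabla X Z) W U
  simp only [covCurv, metric_sub_left]
  linear_combination -h - h1 - h2 - h3

theorem sum_metric_covCurv_frame {x : M} {e : Fin (Module.finrank ℝ E) → SmoothField I M}
    (he : ∀ᶠ y in 𝓝 x, Orthonormal ℝ fun i ↦ e i y) (X Y Z : SmoothField I M) :
    ∑ i, metric (covCurv X (e i) Y Z) (e i) x = covDerivForm (ricHom I M) X Y Z x := by
  have h := sum_covDerivForm_frame he (curvForm Y Z) X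
  have hr : dirDeriv X (∑ i, curvForm Y Z (e i) (e i)) x = dirDeriv X (ric Y Z) x :=
    dirDeriv_apply_of_eventuallyEq (he.mono fun y hy ↦ (ric_apply_frame hy Y Z).symm) X
  have h1 := ric_apply_frame he.self_of_nhds (nabla X Y) Z
  have h2 := ric_apply_frame he.self_of_nhds Y (nabla X Z)
  rw [SmoothFun.sum_apply] at h1 h2
  have hR : covDerivForm (ricHom I M) X Y Z
      = dirDeriv X (ric Y Z) - ric (nabla X Y) Z - ric Y (nabla X Z) := rfl
  simp only [metric_covCurv, SmoothFun.sub_apply, Finset.sum_sub_distrib, h, hr, ← h1, ← h2, hR]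

theorem covDerivForm_ricHom_of_einstein {c : SmoothFun I M}
    (hc : ∀ X Y : SmoothField I M, ric X Y = c * metric X Y) (X Y Z : SmoothField I M) :
    covDerivForm (ricHom I M) X Y Z = dirDeriv X c * metric Y Z := by
  change dirDeriv X (ric Y Z) - ric (nabla X Y) Z - ric Y (nabla X Z) = _
  simp only [hc, dirDeriv_mul, dirDeriv_metric]
  ring

/-- **Schur's lemma**: if the Ricci tensor is a multiple of the metric, the factor has vanishing
derivative unless the dimension is two. -/
theorem dirDeriv_eq_zero_of_einstein {c : SmoothFun I M} (hdim : Module.finrank ℝ E ≠ 2)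
    (hc : ∀ X Y : SmoothField I M, ric X Y = c * metric X Y) (X : SmoothField I M) :
    dirDeriv X c = 0 := by
  ext x
  obtain ⟨e, he⟩ := exists_orthonormal_frame (I := I) x
  have hX : ∑ i, dirDeriv (e i) c x * metric X (e i) x = dirDeriv X c x := by
    have h := congrArg (mvfderiv I c x) (sum_inner_frame_smul he.self_of_nhds (X x))
    rw [map_sum] at h
    refine (Finset.sum_congr rfl fun i _ ↦ ?_).trans h
    rw [map_smul, smul_eq_mul, mul_comm, metric_comm]
    rfl
  have hm (i) : metric (e i) (e i) x = 1 := by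
    rw [metric_apply, real_inner_self_eq_norm_sq, he.self_of_nhds.1 i, one_pow]
  -- The second Bianchi identity is traced twice. Its three terms contribute m X(c), -X(c) and
  -- -X(c), with m the dimension, so (m - 2) X(c) = 0.
  have h1 : ∑ j, ∑ i, metric (covCurv X (e i) (e j) (e j)) (e i) x
      = Module.finrank ℝ E * dirDeriv X c x := by
    simp only [sum_metric_covCurv_frame he, covDerivForm_ricHom_of_einstein hc,
      SmoothFun.mul_apply, hm, mul_one, Finset.sum_const, Finset.card_univ, Fintype.card_fin,
      nsmul_eq_mul]
  have h2 : ∑ j, ∑ i, metric (covCurv (e i) (e j) X (e j)) (e i) x = -dirDeriv X c x := by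
    rw [Finset.sum_comm, ← hX, ← Finset.sum_neg_distrib]
    refine Finset.sum_congr rfl fun i _ ↦ ?_
    simp only [metric_covCurv_swap _ _ _ (e _) (e i), SmoothFun.neg_apply, Finset.sum_neg_distrib,
      sum_metric_covCurv_frame he, covDerivForm_ricHom_of_einstein hc, SmoothFun.mul_apply]
  have h3 : ∑ j, ∑ i, metric (covCurv (e j) X (e i) (e j)) (e i) x = -dirDeriv X c x := by
    rw [← hX, ← Finset.sum_neg_distrib]
    refine Finset.sum_congr rfl fun j _ ↦ ?_
    simp only [covCurv_swap _ X, metric_neg_left, SmoothFun.neg_apply, Finset.sum_neg_distrib,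
      sum_metric_covCurv_frame he, covDerivForm_ricHom_of_einstein hc, SmoothFun.mul_apply]
  have h0 : ∑ j, ∑ i, metric (covCurv X (e i) (e j) (e j)) (e i) x
      + ∑ j, ∑ i, metric (covCurv (e i) (e j) X (e j)) (e i) x
      + ∑ j, ∑ i, metric (covCurv (e j) X (e i) (e j)) (e i) x = 0 := by
    simp only [← Finset.sum_add_distrib]
    refine Finset.sum_eq_zero fun j _ ↦ Finset.sum_eq_zero fun i _ ↦ ?_
    rw [← SmoothFun.add_apply, ← SmoothFun.add_apply, ← metric_add_left, ← metric_add_left,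
      covCurv_cyclic]
    exact inner_zero_left (e i x)
  rw [h1, h2, h3] at h0
  have hd : (Module.finrank ℝ E : ℝ) - 2 ≠ 0 := sub_ne_zero.2 (mod_cast hdim)
  have hmul : ((Module.finrank ℝ E : ℝ) - 2) * dirDeriv X c x = 0 := by linarith
  exact (mul_eq_zero.1 hmul).resolve_left hd

end Schur

/-! ### Curvature of f-Kenmotsu manifolds and the rigidity of symmetric forms -/

section Kenmotsu

variable {E : Type*} [NormedAddCommGroup E] [NormedSpace ℝ E] [FiniteDimensional ℝ E]
  {H : Type*} [TopologicalSpace H] {I : ModelWithCorners ℝ E H}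
  {M : Type*} [TopologicalSpace M] [ChartedSpace H M] [IsManifold I ∞ M]
  [RiemannianBundle (fun x : M ↦ TangentSpace I x)]
  [IsContMDiffRiemannianBundle I ∞ E (fun x : M ↦ TangentSpace I x)]

/-- C^∞(M) can have zero divisors, so cancelling a factor uses that it vanishes nowhere; this is
where regularity acts. -/
theorem SmoothFun.eq_zero_of_mul_eq_zero {h f : SmoothFun I M} (hh : ∀ x, h x ≠ 0)
    (hf : h * f = 0) : f = 0 := by
  ext x
  exact (mul_eq_zero.1 congr($hf x)).resolve_left (hh x)

namespace AlmostContactMetricStructure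

variable (C : AlmostContactMetricStructure I M)

/-- The Reeb field `ξ`. -/
noncomputable def reeb : SmoothField I M := ⟨C.ξ, C.smooth_ξ⟩

/-- The action of `φ` on smooth vector fields. -/
noncomputable def phi : SmoothField I M →ₗ[SmoothFun I M] SmoothField I M where
  toFun X := ⟨fun x ↦ C.φ x (X x), C.smooth_φ.clm_bundle_apply X.contMDiff⟩
  map_add' X Y := by
    ext x
    exact map_add (C.φ x) (X x) (Y x)
  map_smul' f X := by
    ext x
    exact map_smul (C.φ x) (f x) (X x)

theorem phi_apply (X : SmoothField I M) (x : M) : C.phi X x = C.φ x (X x) := rfl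

theorem metric_reeb (X : SmoothField I M) (x : M) : metric X C.reeb x = C.η x (X x) :=
  (C.η_eq x (X x)).symm

theorem metric_reeb_self : metric C.reeb C.reeb = 1 := by
  ext x
  rw [metric_reeb]
  exact C.η_ξ x

theorem phi_phi (X : SmoothField I M) : C.phi (C.phi X) = -X + metric X C.reeb • C.reeb := by
  ext x
  rw [SmoothField.add_apply, SmoothField.smul_apply, metric_reeb]
  exact C.φ_sq x (X x)

theorem phi_reeb : C.phi C.reeb = 0 := by
  ext x
  exact C.φ_ξ x

theorem metric_phi_reeb (X : SmoothField I M) : metric (C.phi X) C.reeb = 0 := by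
  ext x
  rw [metric_reeb]
  exact C.η_φ x (X x)

variable [T2Space M]

/-- The map `Y ↦ (∇_X φ)Y`. -/
noncomputable def covDerivPhi (X : SmoothField I M) :
    SmoothField I M →ₗ[SmoothFun I M] SmoothField I M where
  toFun Y := nabla X (C.phi Y) - C.phi (nabla X Y)
  map_add' Y Z := by
    simp only [map_add, nabla_add]
    abel
  map_smul' f Y := by
    simp only [map_smul, map_add, nabla_smul, RingHom.id_apply]
    module

theorem covDerivEndo_apply (X Y : SmoothField I M) (x : M) :
    covDerivEndo C.φ x (X x) (Y x) = C.covDerivPhi X Y x := by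
  obtain ⟨Y', hY, hY'⟩ := exists_smoothField_eventuallyEq_extend (Y x)
  rw [← field_linear_apply_eq (C.covDerivPhi X) hY]
  have h : ∀ᶠ y in 𝓝 x, C.φ y (FiberBundle.extend E (Y x) y) = C.phi Y' y := by
    filter_upwards [hY'] with y hy
    rw [hy, phi_apply]
  simp only [covDerivEndo]
  rw [leviCivita_apply_of_eventuallyEq h, leviCivita_apply_of_eventuallyEq hY']
  rfl

end AlmostContactMetricStructure

variable [T2Space M] {C : AlmostContactMetricStructure I M} {f : M → ℝ}

namespace IsFKenmotsu

/-- The function `f` of an `f`-Kenmotsu manifold, as a smooth function. -/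
def toSmoothFun (hf : IsFKenmotsu C f) : SmoothFun I M := ⟨f, hf.smooth⟩

theorem covDerivPhi_eq (hf : IsFKenmotsu C f) (X Y : SmoothField I M) :
    C.covDerivPhi X Y
      = hf.toSmoothFun • (metric (C.phi X) Y • C.reeb - metric Y C.reeb • C.phi X) := by
  ext x
  rw [← C.covDerivEndo_apply, hf.covDeriv_φ, SmoothField.smul_apply, SmoothField.sub_apply,
    SmoothField.smul_apply, SmoothField.smul_apply, C.metric_reeb]
  rfl

/-- This is df ∧ η = 0 evaluated on X and ξ. -/
theorem dirDeriv_eq (hf : IsFKenmotsu C f) (X : SmoothField I M) :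
    dirDeriv X hf.toSmoothFun = dirDeriv C.reeb hf.toSmoothFun * metric X C.reeb := by
  ext x
  have h := hf.wedge x (X x) (C.ξ x)
  rw [C.η_ξ, mul_one, sub_eq_zero] at h
  rw [SmoothFun.mul_apply, C.metric_reeb]
  exact h

/-- Since φξ = 0, the formula for (∇_X φ)ξ reads φ(∇_X ξ) = f φX. Applying φ recovers ∇_X ξ up to
its ξ-component, which is zero because ξ has unit length. -/
theorem nabla_reeb (hf : IsFKenmotsu C f) (X : SmoothField I M) :
    nabla X C.reeb = hf.toSmoothFun • (X - metric X C.reeb • C.reeb) := by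
  have h1 : nabla X (C.phi C.reeb) - C.phi (nabla X C.reeb) = _ := hf.covDerivPhi_eq X C.reeb
  have h0 : nabla X (0 : SmoothField I M) = 0 := map_zero (nablaHom I M X)
  rw [C.phi_reeb, h0, C.metric_phi_reeb, C.metric_reeb_self] at h1
  have h2 := congrArg C.phi h1
  have h3 := dirDeriv_metric X C.reeb C.reeb
  rw [C.metric_reeb_self, dirDeriv_one, metric_comm C.reeb] at h3
  have h4 : metric (nabla X C.reeb) C.reeb = 0 := by
    ext x
    have := congr($h3 x)
    simp only [SmoothFun.add_apply, SmoothFun.zero_apply] at this ⊢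
    linarith
  simp only [map_sub, map_smul, map_zero, C.phi_phi, C.phi_reeb, h4] at h2
  linear_combination (norm := module) h2

/-- The function `f² + ξ(f)`. -/
noncomputable def curvFun (hf : IsFKenmotsu C f) : SmoothFun I M :=
  hf.toSmoothFun * hf.toSmoothFun + dirDeriv C.reeb hf.toSmoothFun

theorem curvFun_ne_zero (hf : IsFKenmotsu C f) (hreg : IsRegular C f) (x : M) :
    hf.curvFun x ≠ 0 := by
  have h := hreg x
  rw [pow_two] at h
  exact h

/-- Differentiating ∇ξ produces f² from the connection terms and ξ(f) from X(f) = ξ(f) η(X); the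
ξ-components cancel by antisymmetry in X and Y. -/
theorem curv_reeb (hf : IsFKenmotsu C f) (X Y : SmoothField I M) :
    curv X Y C.reeb = hf.curvFun • (metric X C.reeb • Y - metric Y C.reeb • X) := by
  simp only [curv, hf.nabla_reeb, nabla_smul, nabla_sub, dirDeriv_metric, ← nabla_sub_nabla X Y,
    hf.dirDeriv_eq X, hf.dirDeriv_eq Y, metric_sub_left, metric_smul_right, metric_sub_right,
    metric_comm Y X, curvFun]
  module

end IsFKenmotsu

/-- On a regular `f`-Kenmotsu manifold, a symmetric pairing annihilated by the curvature operators
is a multiple of the metric. -/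
theorem form_eq_mul_metric (hf : IsFKenmotsu C f) (hreg : IsRegular C f) {A : SmoothForm I M}
    (hA : ∀ X Y, A X Y = A Y X)
    (hR : ∀ X Y Z W, A (curv X Y Z) W + A Z (curv X Y W) = 0) (X Y : SmoothField I M) :
    A X Y = A C.reeb C.reeb * metric X Y := by
  have h1 (Y : SmoothField I M) : A Y C.reeb = metric Y C.reeb * A C.reeb C.reeb := by
    -- Here R(ξ,Y)ξ = F (Y - η(Y)ξ), with F = f² + ξ(f), so the condition becomes 2F (A(Y,ξ) - η(Y)
    -- A(ξ,ξ)) = 0.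
    have h := hR C.reeb Y C.reeb C.reeb
    rw [hA C.reeb, hf.curv_reeb, C.metric_reeb_self] at h
    simp only [map_smul, map_sub, LinearMap.smul_apply, LinearMap.sub_apply, smul_eq_mul] at h
    refine sub_eq_zero.1 (SmoothFun.eq_zero_of_mul_eq_zero (hf.curvFun_ne_zero hreg) ?_)
    ext x
    have := congr($h x)
    simp only [SmoothFun.add_apply, SmoothFun.sub_apply, SmoothFun.mul_apply,
      SmoothFun.zero_apply, SmoothFun.one_apply] at this ⊢
    linarith
  -- By `h1` the first term is A(ξ,ξ) g(R(ξ,Y)X, ξ), which skew-symmetry turns into -A(ξ,ξ)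
  -- g(R(ξ,Y)ξ, X); both terms then involve only R(ξ,Y)ξ.
  have h := hR C.reeb Y X C.reeb
  have h2 := metric_curv_swap C.reeb Y X C.reeb
  rw [h1, h2, hf.curv_reeb, C.metric_reeb_self] at h
  simp only [map_smul, map_sub, smul_eq_mul, h1 X, metric_smul_left, metric_sub_left] at h
  refine sub_eq_zero.1 (SmoothFun.eq_zero_of_mul_eq_zero (hf.curvFun_ne_zero hreg) ?_)
  rw [metric_comm Y X, metric_comm C.reeb X] at h
  linear_combination h

/-- As A = A(ξ,ξ) g, the correction terms in (∇_X A)(ξ,ξ) are multiples of g(∇_X ξ, ξ) = 0, so only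
the derivative of A(ξ,ξ) remains. -/
theorem dirDeriv_parallel_form_reeb (hf : IsFKenmotsu C f) (hreg : IsRegular C f)
    {A : SmoothForm I M} (hA : ∀ X Y, A X Y = A Y X) (hpar : ∀ X, covDerivForm A X = 0)
    (X : SmoothField I M) : dirDeriv X (A C.reeb C.reeb) = 0 := by
  have h := form_eq_mul_metric hf hreg hA (curv_form_eq_zero hpar)
  have h0 : covDerivForm A X C.reeb C.reeb = 0 := congr($(hpar X) C.reeb C.reeb)
  have hm := dirDeriv_metric X C.reeb C.reeb
  rw [C.metric_reeb_self, dirDeriv_one] at hm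
  rw [covDerivForm_apply, h (nabla X C.reeb), h _ (nabla X C.reeb)] at h0
  linear_combination h0 - A C.reeb C.reeb * hm

theorem IsSemisymmetric.isRicciSemisymmetric (h : IsSemisymmetric I M) :
    IsRicciSemisymmetric I M := by
  intro x X Y X₁ X₂
  -- R·R = 0 writes the sum of endomorphisms whose traces are the two Ricci terms as a commutator
  -- with R(X,Y), which has trace zero.
  have hc : curvatureLeft (curvature X Y X₁) X₂ + curvatureLeft X₁ (curvature X Y X₂)
      = curvatureRight X Y * curvatureLeft X₁ X₂ - curvatureLeft X₁ X₂ * curvatureRight X Y := by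
    ext u
    have hu : curvature X Y (curvature u X₁ X₂) - curvature (curvature X Y u) X₁ X₂
      - curvature u (curvature X Y X₁) X₂ - curvature u X₁ (curvature X Y X₂) = 0 := h x X Y u X₁ X₂
    change curvature u (curvature X Y X₁) X₂ + curvature u X₁ (curvature X Y X₂)
      = curvature X Y (curvature u X₁ X₂) - curvature (curvature X Y u) X₁ X₂
    linear_combination (norm := module) -hu
  have ht := congrArg (LinearMap.trace ℝ (TangentSpace I x)) hc
  rw [map_add, map_sub, LinearMap.trace_mul_comm, sub_self, ← ricci_eq_trace,
    ← ricci_eq_trace] at ht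
  linarith

theorem IsRicciSemisymmetric.curv_ricHom (h : IsRicciSemisymmetric I M)
    (X Y Z W : SmoothField I M) :
    ricHom I M (curv X Y Z) W + ricHom I M Z (curv X Y W) = 0 := by
  ext x
  have hx := h x (X x) (Y x) (Z x) (W x)
  rw [curvature_apply, curvature_apply] at hx
  change ricci I M x (curv X Y Z x) (W x) + ricci I M x (Z x) (curv X Y W x) = 0
  linarith

end Kenmotsu

/-! ### From proportionality to the metric to the soliton equation -/

theorem isRicciSoliton_of_form {E : Type*} [NormedAddCommGroup E] [NormedSpace ℝ E]
    [FiniteDimensional ℝ E] {H : Type*} [TopologicalSpace H] {I : ModelWithCorners ℝ E H}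
    {M : Type*} [TopologicalSpace M] [ChartedSpace H M] [IsManifold I ∞ M]
    [RiemannianBundle (fun x : M ↦ TangentSpace I x)]
    [IsContMDiffRiemannianBundle I ∞ E (fun x : M ↦ TangentSpace I x)] [T2Space M]
    {V : SmoothField I M} {c : ℝ}
    (h : ∀ (X Y : SmoothField I M) (x : M),
      lieDerivMetricHom V X Y x + 2 * ric X Y x = c * metric X Y x) :
    IsRicciSoliton V (-c / 2) := by
  intro x u v
  obtain ⟨X, rfl⟩ := exists_smoothField_apply_eq u
  obtain ⟨Y, rfl⟩ := exists_smoothField_apply_eq v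
  rw [lieDerivMetric_apply, ← ric_apply, ← metric_apply]
  linarith [h X Y x]

end FKenmotsu

open FKenmotsu

theorem corollary2 {n : ℕ} {M : Type*} [TopologicalSpace M] [T2Space M]
    [SecondCountableTopology M] [ConnectedSpace M]
    [ChartedSpace (EuclideanSpace ℝ (Fin (2 * n + 1))) M] [IsManifold (𝓡 (2 * n + 1)) ∞ M]
    [RiemannianBundle (fun x : M ↦ TangentSpace (𝓡 (2 * n + 1)) x)]
    [IsContMDiffRiemannianBundle (𝓡 (2 * n + 1)) ∞ (EuclideanSpace ℝ (Fin (2 * n + 1)))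
      (fun x : M ↦ TangentSpace (𝓡 (2 * n + 1)) x)]
    (C : FKenmotsu.AlmostContactMetricStructure (𝓡 (2 * n + 1)) M) (f : M → ℝ)
    (hf : FKenmotsu.IsFKenmotsu C f) (hreg : FKenmotsu.IsRegular C f)
    (V : Π x : M, TangentSpace (𝓡 (2 * n + 1)) x)
    (hV : ContMDiff (𝓡 (2 * n + 1)) ((𝓡 (2 * n + 1)).prod 𝓘(ℝ, EuclideanSpace ℝ (Fin (2 * n + 1)))) ∞
      fun x ↦ (TotalSpace.mk' (EuclideanSpace ℝ (Fin (2 * n + 1))) x (V x) :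
        TotalSpace (EuclideanSpace ℝ (Fin (2 * n + 1)))
          fun x : M ↦ TangentSpace (𝓡 (2 * n + 1)) x)) :
    (FKenmotsu.IsParallel (fun x u v ↦ FKenmotsu.lieDerivMetric V x u v
        + 2 * FKenmotsu.ricci (𝓡 (2 * n + 1)) M x u v) →
      ∃ lam : ℝ, FKenmotsu.IsRicciSoliton V lam) ∧
    ((FKenmotsu.IsRicciSemisymmetric (𝓡 (2 * n + 1)) M ∨
        FKenmotsu.IsSemisymmetric (𝓡 (2 * n + 1)) M) →
      FKenmotsu.IsParallel (FKenmotsu.lieDerivMetric V) →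
      ∃ lam : ℝ, FKenmotsu.IsRicciSoliton V lam) := by
  -- Odd dimension excludes the exceptional case of Schur's lemma.
  have hdim : Module.finrank ℝ (EuclideanSpace ℝ (Fin (2 * n + 1))) ≠ 2 := by
    rw [finrank_euclideanSpace_fin]
    omega
  let W : SmoothField (𝓡 (2 * n + 1)) M := ⟨V, hV⟩
  have hconst (f : SmoothFun (𝓡 (2 * n + 1)) M) (h : ∀ X, dirDeriv X f = 0) :
      ∃ c, ∀ x, f x = c :=
    exists_eq_const_of_mvfderiv_eq_zero f.contMDiff (mvfderiv_eq_zero_of_dirDeriv_eq_zero h)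
  refine ⟨fun hpar ↦ ?_, fun hsym hpar ↦ ?_⟩
  · let A : SmoothForm (𝓡 (2 * n + 1)) M := lieDerivMetricHom W + (ricHom _ M + ricHom _ M)
    have hA (X Y : SmoothField (𝓡 (2 * n + 1)) M) (x : M) :
        A X Y x = lieDerivMetricHom W X Y x + 2 * ric X Y x := by
      rw [two_mul (ric X Y x)]
      rfl
    have hsymm (X Y : SmoothField (𝓡 (2 * n + 1)) M) : A X Y = A Y X := by
      ext x
      rw [hA, hA, lieDerivMetricHom_comm, ric_comm]
    have hparA := covDerivForm_eq_zero_of_isParallel (A := A) (fun X Y x ↦ by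
      rw [hA, ← lieDerivMetric_apply]; rfl) hpar
    obtain ⟨c, hc⟩ := hconst _ (dirDeriv_parallel_form_reeb hf hreg hsymm hparA)
    refine ⟨-c / 2, isRicciSoliton_of_form (V := W) fun X Y x ↦ ?_⟩
    rw [← hA, form_eq_mul_metric hf hreg hsymm (curv_form_eq_zero hparA), SmoothFun.mul_apply, hc]
  · have hparA := covDerivForm_eq_zero_of_isParallel (A := lieDerivMetricHom W)
      (fun X Y x ↦ (lieDerivMetric_apply W X Y x).symm) hpar
    have hL := form_eq_mul_metric hf hreg (lieDerivMetricHom_comm W) (curv_form_eq_zero hparA)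
    obtain ⟨c, hc⟩ := hconst _
      (dirDeriv_parallel_form_reeb hf hreg (lieDerivMetricHom_comm W) hparA)
    have hS := form_eq_mul_metric hf hreg ric_comm
      (hsym.elim id IsSemisymmetric.isRicciSemisymmetric).curv_ricHom
    obtain ⟨d, hd⟩ := hconst _ (dirDeriv_eq_zero_of_einstein hdim hS)
    -- With L_V g = c g and S = d g, the sum L_V g + 2S equals (c + 2d) g.
    refine ⟨-(c + 2 * d) / 2, isRicciSoliton_of_form (V := W) fun X Y x ↦ ?_⟩
    have hSx : ric X Y x = d * metric X Y x := by rw [← hd x]; exact congr($(hS X Y) x)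
    rw [hL, SmoothFun.mul_apply, hc, hSx]
    ring
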